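/- **Model.** A probabilistic Turing machine (PTM) has a two-way read-only input tape holding the input word between two end-markers (which the input head never passes) and one two-way infinite work tape. Its transition function assigns to each state $q$, scanned input symbol $\sigma$ and scanned work symbol $\gamma$ a probability distribution on the actions (new state, input head move, written work symbol, work head move). All transition probabilities $p$ are polynomial-time computable: some deterministic algorithm computes $p$ to within $2^{-n}$ in time polynomial in $n$. The computation stops as soon as a halting state is entered. A standard PTM has accepting and rejecting halting states. A PTM with postselection has postselection-accept, postselection-reject and nonpostselection halting states, and on every input $w$ the probabilities $p^a(w)$ and $p^r(w)$ of halting in a postselection-accept, respectively a postselection-reject, state satisfy $p^a(w)+p^r(w)>0$; one puts $P(\text{accept } w)=\frac{p^a(w)}{p^a(w)+p^r(w)}$ and $P(\text{reject } w)=\frac{p^r(w)}{p^a(w)+p^r(w)}$. A machine runs in time $t$ if on every input of length $n$ every computation path of nonzero probability halts within $t(n)$ steps. It uses space $O(s)$ if, for some function $f=O(s)$, on every input of length $n$ at most $f(n)$ work tape cells are ever visited with nonzero probability. **Classes.** Fix a finite input alphabet. * $\mathsf{NSPACE}(s)$ is the class of languages recognized with cutpoint zero ($w\in L \iff P(\text{accept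 } w)>0$) by standard PTMs using space $O(s)$, that is, by nondeterministic machines using space $O(s)$. * $\mathsf{PostRTISP}(T,s)$, for a set $T$ of time bounds, is the class of languages recognized with one-sided bounded error by PTMs with postselection that, simultaneously, run in time $t$ for some $t\in T$ and use space $O(s)$. One-sided bounded error means that $w\in L\iff P(\text{accept } w)>0$ and that there is an $\varepsilon$ with $0\le\varepsilon<\frac12$ such that $P(\text{accept } w)\ge 1-\varepsilon$ for all $w\in L$ and $P(\text{reject } w)\ge 1-\varepsilon$ for all $w\notin L$. A function $s:\mathbb N\to\mathbb N$ is space-constructible if some deterministic machine of the above kind that uses space $O(s)$ halts on every input $1^n$ with exactly $s(n)$ nonblank cells on its work tape. **Theorem.** For every space-constructible function $s$ with $s(n)=\Omega(\log n)$, $$\mathsf{NSPACE}(s)=\mathsf{PostRTISP}(2^{O(s)},s).$$ In particular, $\mathsf{NL}=\mathsf{PostRL}$, where $\mathsf{NL}=\mathsf{NSPACE}(\log n)$ and $\mathsf{PostRL}=\mathsf{PostRTISP}(\mathrm{poly}(n),\log n)$ is the postselected version of $\mathsf{RL}=\mathsf{RTISP}(\mathrm{poly}(n),\log n)$. -/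

import Mathlib

namespace PostTM

open Filter Asymptotics

/-- A nonnegative real number `p` lies in `ℝ̃` if some deterministic algorithm, given `n` in unary,
computes in time polynomial in `n` a numerator `f n` (in binary) such that `f n / 2 ^ n` approximates
`p` to within `2 ^ (-n)`. -/
def PolyTimeReal (p : ℝ) : Prop :=
  0 ≤ p ∧ ∃ f : ℕ → ℕ,
    Nonempty (Turing.TM2ComputableInPolyTime
      Computability.unaryEncodeNat Computability.encodeNat f) ∧
    ∀ n : ℕ, |p - (f n : ℝ) / 2 ^ n| ≤ 1 / 2 ^ n

/-- The contents of an input tape cell: an end-marker or an input letter. -/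
inductive InputSymbol (α : Type*) where
  | leftEnd : InputSymbol α
  | rightEnd : InputSymbol α
  | letter (a : α) : InputSymbol α

/-- Head moves. -/
inductive Move where
  | left : Move
  | right : Move
  | stay : Move
  deriving DecidableEq

instance : Fintype Move :=
  ⟨{.left, .right, .stay}, by intro d; cases d <;> simp⟩

/-- What cell `i` of the input tape contains: the left end-marker at `0`, the word `w` at
`1, …, |w|`, and the right end-marker at `|w| + 1`. -/
def inputAt {α : Type*} (w : List α) : ℕ → InputSymbol α
  | 0 => .leftEnd
  | i + 1 => match w[i]? with
    | some a => .letter a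
    | none => .rightEnd

/-- A well-formed probabilistic Turing machine with input alphabet `α`, a two-way read-only input
tape with end-markers and one two-way infinite work tape. `Δ` is the type of halting outcomes;
`outcome` partitions the states, `none` meaning that the computation continues.
`δ q σ γ (q', dᵢ, γ', d_w)` is the probability of going to state `q'`, writing `γ'` on the work
tape and moving the two heads by `dᵢ` and `d_w`, when in state `q` reading `σ` and `γ`. -/
structure Machine (α : Type*) (Δ : Type) where
  Q : Type
  Γ : Type
  [fintypeQ : Fintype Q]
  [fintypeΓ : Fintype Γ]
  blank : Γ
  start : Q
  outcome : Q → Option Δ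
  δ : Q → InputSymbol α → Γ → Q × Move × Γ × Move → ℝ
  δ_polyTime : ∀ q σ γ r, PolyTimeReal (δ q σ γ r)
  δ_sum : ∀ q σ γ, ∑ r, δ q σ γ r = 1
  /-- The input head never leaves the area delimited by the end-markers. -/
  δ_leftEnd : ∀ q γ q' γ' d, δ q .leftEnd γ (q', .left, γ', d) = 0
  δ_rightEnd : ∀ q γ q' γ' d, δ q .rightEnd γ (q', .right, γ', d) = 0

attribute [instance] Machine.fintypeQ Machine.fintypeΓ

namespace Machine

variable {α : Type*} {Δ : Type}

/-- A configuration: internal state, positions of both heads, contents of the work tape. -/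
@[ext]
structure Config (M : Machine α Δ) where
  state : M.Q
  inputPos : ℕ
  workPos : ℤ
  work : ℤ → M.Γ

/-- The initial configuration. -/
def init (M : Machine α Δ) : M.Config := ⟨M.start, 0, 0, fun _ => M.blank⟩

/-- The new position of the input head. -/
def moveInput (i : ℕ) : Move → ℕ
  | .left => i - 1
  | .right => i + 1
  | .stay => i

/-- The new position of the work head. -/
def moveWork (z : ℤ) : Move → ℤ
  | .left => z - 1
  | .right => z + 1
  | .stay => z

/-- The configuration that results from performing the action `r` in configuration `c`. -/
def next (M : Machine α Δ) (c : M.Config) (r : M.Q × Move × M.Γ × Move) : M.Config :=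
  ⟨r.1, moveInput c.inputPos r.2.1, moveWork c.workPos r.2.2.2,
    Function.update c.work c.workPos r.2.2.1⟩

/-- The probability of performing the action `r` in configuration `c`, on input `w`. -/
def prob (M : Machine α Δ) (w : List α) (c : M.Config) (r : M.Q × Move × M.Γ × Move) : ℝ :=
  M.δ c.state (inputAt w c.inputPos) (c.work c.workPos) r

/-- The probability that the machine, started in configuration `c` on input `w`, halts with
outcome `o` after at most the given number of steps. -/
noncomputable def haltProbWithin [DecidableEq Δ] (M : Machine α Δ) (w : List α) (o : Δ) :
    ℕ → M.Config → ℝ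
  | 0, c => if M.outcome c.state = some o then 1 else 0
  | k + 1, c => match M.outcome c.state with
    | some o' => if o' = o then 1 else 0
    | none => ∑ r, M.prob w c r * haltProbWithin M w o k (M.next c r)

/-- The probability that the machine halts with outcome `o` on input `w`. -/
noncomputable def haltProb [DecidableEq Δ] (M : Machine α Δ) (w : List α) (o : Δ) : ℝ :=
  ⨆ k : ℕ, M.haltProbWithin w o k M.init

/-- `M.ReachedIn w k c`: on input `w` the machine is with nonzero probability in configuration `c`
after exactly `k` steps. -/
inductive ReachedIn (M : Machine α Δ) (w : List α) : ℕ → M.Config → Prop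
  | init : ReachedIn M w 0 M.init
  | step {k : ℕ} {c : M.Config} {r : M.Q × Move × M.Γ × Move} :
      ReachedIn M w k c → M.outcome c.state = none → 0 < M.prob w c r →
      ReachedIn M w (k + 1) (M.next c r)

/-- On inputs of length `n`, every computation path halts after at most `t n` steps. -/
def RunsInTime (M : Machine α Δ) (t : ℕ → ℕ) : Prop :=
  ∀ (w : List α) (k : ℕ) (c : M.Config),
    M.ReachedIn w k c → M.outcome c.state = none → k < t w.length

/-- The work tape cells that are ever visited with nonzero probability on input `w`. -/
def visited (M : Machine α Δ) (w : List α) : Set ℤ :=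
  {z | ∃ (k : ℕ) (c : M.Config), M.ReachedIn w k c ∧ c.workPos = z}

/-- On inputs of length `n`, at most `f n` work tape cells are ever visited. -/
def UsesSpace (M : Machine α Δ) (f : ℕ → ℕ) : Prop :=
  ∀ w : List α, (M.visited w).encard ≤ (f w.length : ℕ∞)

/-- All transition probabilities are `0` or `1`. -/
def IsDeterministic (M : Machine α Δ) : Prop :=
  ∀ q σ γ r, M.δ q σ γ r = 0 ∨ M.δ q σ γ r = 1

end Machine

/-- Halting outcomes of a standard machine. -/
inductive StdOutcome where
  | accept : StdOutcome
  | reject : StdOutcome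
  deriving DecidableEq

/-- Halting outcomes of a machine with postselection. -/
inductive PostOutcome where
  | postAccept : PostOutcome
  | postReject : PostOutcome
  | nonpost : PostOutcome
  deriving DecidableEq

/-- The standard probabilistic Turing machines. -/
abbrev PTM (α : Type*) := Machine α StdOutcome

/-- `f = O(g)` for functions on the natural numbers. -/
def IsBigONat (f g : ℕ → ℕ) : Prop :=
  (fun n => (f n : ℝ)) =O[atTop] (fun n => (g n : ℝ))

/-- `NSPACE(s)`: the languages recognized with cutpoint zero by probabilistic Turing machines
using space `O(s)`. -/
def NSPACE (α : Type*) (s : ℕ → ℕ) : Set (Language α) :=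
  {L | ∃ (M : PTM α) (f : ℕ → ℕ), IsBigONat f s ∧ M.UsesSpace f ∧
    ∀ w : List α, w ∈ L ↔ 0 < M.haltProb w .accept}

/-- A probabilistic Turing machine with postselection: on every input it halts in a postselection
state with nonzero probability. -/
structure PostPTM (α : Type*) extends Machine α PostOutcome where
  post_pos : ∀ w : List α,
    0 < toMachine.haltProb w .postAccept + toMachine.haltProb w .postReject

namespace PostPTM

variable {α : Type*}

/-- The overall acceptance probability. -/
noncomputable def acceptProb (M : PostPTM α) (w : List α) : ℝ :=
  M.haltProb w .postAccept / (M.haltProb w .postAccept + M.haltProb w .postReject)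

/-- The overall rejection probability. -/
noncomputable def rejectProb (M : PostPTM α) (w : List α) : ℝ :=
  M.haltProb w .postReject / (M.haltProb w .postAccept + M.haltProb w .postReject)

/-- Recognition with one-sided bounded error: with cutpoint zero and with bounded error. -/
def RecognizesOneSided (M : PostPTM α) (L : Language α) : Prop :=
  (∀ w : List α, w ∈ L ↔ 0 < M.acceptProb w) ∧
  ∃ ε : ℝ, 0 ≤ ε ∧ ε < 1 / 2 ∧
    (∀ w : List α, w ∈ L → 1 - ε ≤ M.acceptProb w) ∧
    (∀ w : List α, w ∉ L → 1 - ε ≤ M.rejectProb w)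

end PostPTM

/-- `PostRTISP(T, s)`: the languages recognized with one-sided bounded error by probabilistic
Turing machines with postselection running in time `t` for some `t ∈ T` and, simultaneously,
using space `O(s)`. -/
def PostRTISP (α : Type*) (T : Set (ℕ → ℕ)) (s : ℕ → ℕ) : Set (Language α) :=
  {L | ∃ (M : PostPTM α) (t f : ℕ → ℕ), t ∈ T ∧ IsBigONat f s ∧
    M.RunsInTime t ∧ M.UsesSpace f ∧ M.RecognizesOneSided L}

/-- The time bounds `2 ^ O(s)`. -/
def twoPowBigO (s : ℕ → ℕ) : Set (ℕ → ℕ) :=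
  {t | ∃ g : ℕ → ℕ, IsBigONat g s ∧ t = fun n => 2 ^ g n}

/-- The time bounds `poly(n)`. -/
def polyBounds : Set (ℕ → ℕ) :=
  {t | ∃ p : Polynomial ℕ, t = fun n => p.eval n}

/-- `s` is space-constructible: some deterministic Turing machine using space `O(s)` halts on every
input `1ⁿ` with exactly `s n` nonblank cells on its work tape. -/
def SpaceConstructible (s : ℕ → ℕ) : Prop :=
  ∃ (M : PTM Unit) (f : ℕ → ℕ), M.IsDeterministic ∧ IsBigONat f s ∧ M.UsesSpace f ∧
    ∀ n : ℕ, ∃ (k : ℕ) (c : M.Config), M.ReachedIn (List.replicate n ()) k c ∧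
      M.outcome c.state ≠ none ∧ {z : ℤ | c.work z ≠ M.blank}.encard = (s n : ℕ∞)

/-- `NL = NSPACE(log n)`. -/
def NL (α : Type*) : Set (Language α) := NSPACE α (fun n => Nat.log 2 n)

/-- The postselected version of `RL`, that is, `PostRTISP(poly(n), log n)`. -/
def PostRL (α : Type*) : Set (Language α) := PostRTISP α polyBounds (fun n => Nat.log 2 n)

end PostTM

namespace PostTM

/-! ### Transition probabilities: `0` and `1 / 2 ^ m` are polynomial-time computable. -/

section PolyTimeReal

open Computability Turing Turing.TM2.Stmt

/-! A machine with postselection that accepts with positive overall probability has a path of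
nonzero probability to a postselection-accept state, and conversely. Calling all other outcomes
rejection therefore gives a nondeterministic machine in the same space (`PostRTISP_subset_NSPACE`).

For the other inclusion, a nondeterministic machine `M` is simulated by guessing one action per
round with `m` random bits per step, under a clock that admits at least as many rounds as `M` has
configurations. If `M` accepts, it does so within the clock, so a guess that accepts exists. A
simulation that dies or loops waits for the clock to run out at a time `X` which depends only on the
input. The only postselected rejection is the run that reaches time `X` with all random bits zero.
With `β = 1 / 2 ^ m`, rejection has probability at most `β ^ (X - 1)`, while an accepting run of `k
≤ X - 2` steps has probability at least `β ^ k`. So for members rejection is at most half as likely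
as acceptance, and the error is at most `1/3`. For nonmembers acceptance is impossible and the
all-zero run rejects. This is `mem_PostRTISP`, with `haltProb_le` and `le_haltProb` for the two
estimates.

The simulator has to respect space `O(s)` without losing control of its timing. It first runs a
deterministic machine `D` on the length of the input, marking the cells that `D` scans. They form an
interval of `v` cells with `s ≤ v = O(s)`. Each cell then holds a block of the tape of `M` to the
right of its head, a block of the tape to the left, and a digit of the clock. A move of `M` pushes
on one of these two stacks and pops the other. One sweep to the right pushes and increments the
clock, one sweep to the left pops, so every complete round takes exactly `2 * v + 3` steps
(`exists_round`, `simulator_halts`). Since `s = Ω(log n)`, the number of configurations is `2 ^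
O(v)`, which the clock can count.

For `NL = PostRL` the role of `D` is played by a binary counter of the input length, and `2 ^ O(log
n)` is polynomial. -/

theorem unaryEncodeNat_eq_replicate (n : ℕ) : unaryEncodeNat n = List.replicate n true := by
  induction n with
  | zero => rfl
  | succ n ih => rw [unaryEncodeNat, ih, List.replicate_succ]

/-- The same word is the unary encoding of `n`, so an approximation of the form `2 ^ j - 1` can be
output in binary without any arithmetic. -/
theorem encodeNat_two_pow_sub_one (n : ℕ) : encodeNat (2 ^ n - 1) = List.replicate n true := by
  have key : ∀ n : ℕ, ∃ p : PosNum, (p : ℕ) = 2 ^ (n + 1) - 1 ∧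
      encodePosNum p = List.replicate (n + 1) true := by
    intro n
    induction n with
    | zero => exact ⟨PosNum.one, rfl, rfl⟩
    | succ n ih =>
      obtain ⟨p, hp, he⟩ := ih
      refine ⟨PosNum.bit1 p, ?_, ?_⟩
      · rw [PosNum.cast_bit1, hp]
        have : 1 ≤ 2 ^ (n + 1) := Nat.one_le_two_pow
        rw [pow_succ 2 (n + 1)]
        lia
      · rw [encodePosNum, he, List.replicate_succ (n := n + 1)]
  cases n with
  | zero => rfl
  | succ n =>
    obtain ⟨p, hp, he⟩ := key n
    have : ((2 ^ (n + 1) - 1 : ℕ) : Num) = Num.pos p := by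
      rw [← hp]
      exact Num.of_to_nat (Num.pos p)
    rw [encodeNat, this, encodeNum, he]

/-- The machine that empties its stack. -/
def clearMachine : FinTM2 where
  K := Unit
  k₀ := ()
  k₁ := ()
  Γ _ := Bool
  Λ := Unit
  main := ()
  σ := Bool
  initialState := false
  m _ := pop () (fun _ o => o.isSome) (branch id (goto fun _ => ()) halt)

theorem polyTimeReal_zero : PolyTimeReal 0 := by
  -- The numeral of `0` is the empty word: `n` symbols are popped, and one more step finds the stack
  -- empty.
  refine ⟨le_rfl, fun _ => 0, ⟨⟨⟨clearMachine, Equiv.refl _, Equiv.refl _⟩, Polynomial.X + 1,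
    fun n => ⟨⟨(unaryEncodeNat n).length + 1, ?_⟩, ?_⟩⟩⟩, fun n => by simp⟩
  · have key : ∀ (l : List Bool) (b : Bool),
        (flip Option.bind clearMachine.step)^[l.length + 1]
          (some (⟨some (), b, fun _ => l⟩ : clearMachine.Cfg)) =
          some (⟨none, false, fun _ => []⟩ : clearMachine.Cfg) := by
      intro l
      induction l with
      | nil =>
        intro b
        rfl
      | cons a l ih =>
        intro b
        rw [List.length_cons, Function.iterate_succ_apply]
        refine Eq.trans ?_ (ih true)
        rfl
    have := key (unaryEncodeNat n) false
    simp only [Equiv.invFun_as_coe, Equiv.refl_symm, Equiv.coe_refl]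
    erw [List.map_id]
    exact this
  · simp

/-- Pop `m` times, then halt. -/
def popStmt : ℕ → TM2.Stmt (fun _ : Unit => Bool) Unit Unit
  | 0 => halt
  | m + 1 => pop () (fun _ _ => ()) (popStmt m)

/-- The machine that drops the first `m` symbols of its stack. -/
def dropMachine (m : ℕ) : FinTM2 where
  K := Unit
  k₀ := ()
  k₁ := ()
  Γ _ := Bool
  Λ := Unit
  main := ()
  σ := Unit
  initialState := ()
  m _ := popStmt m

theorem stepAux_popStmt (m : ℕ) (l : List Bool) :
    TM2.stepAux (popStmt m) () (fun _ => l) = ⟨none, (), fun _ => l.drop m⟩ := by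
  induction m generalizing l with
  | zero => rfl
  | succ m ih =>
    rw [popStmt, TM2.stepAux]
    have : (Function.update (fun _ : Unit => l) () l.tail) = fun _ => l.tail := by
      funext x; cases x; simp
    rw [this, ih]
    simp

/-- The approximation `(2 ^ (n - m) - 1) / 2 ^ n` is off by exactly `1 / 2 ^ n` when `m ≤ n`; when
`n < m` it is `0`, which is good enough. Dropping `m` symbols from the unary input produces its
numerator in a single step. -/
theorem polyTimeReal_two_pow (m : ℕ) : PolyTimeReal (1 / 2 ^ m) := by
  refine ⟨by positivity, fun n => 2 ^ (n - m) - 1,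
    ⟨⟨⟨dropMachine m, Equiv.refl _, Equiv.refl _⟩, 1, fun n => ⟨⟨1, ?_⟩, by simp⟩⟩⟩, fun n => ?_⟩
  · simp only [Equiv.invFun_as_coe, Equiv.refl_symm, Equiv.coe_refl]
    rw [encodeNat_two_pow_sub_one, unaryEncodeNat_eq_replicate]
    have h := stepAux_popStmt m (List.replicate n true)
    rw [List.drop_replicate] at h
    erw [List.map_id, List.map_id]
    exact congrArg some h
  · rw [Nat.cast_sub Nat.one_le_two_pow]
    push_cast
    rcases le_total m n with h | h
    · have : (2 : ℝ) ^ n = 2 ^ (n - m) * 2 ^ m := by rw [← pow_add, Nat.sub_add_cancel h]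
      have e : (1 : ℝ) / 2 ^ m - (2 ^ (n - m) - 1) / 2 ^ n = 1 / 2 ^ n := by
        rw [this]; field_simp; ring
      rw [e, abs_of_nonneg (by positivity)]
    · rw [Nat.sub_eq_zero_of_le h]
      simp only [pow_zero, sub_self, zero_div, sub_zero]
      rw [abs_of_nonneg (by positivity)]
      exact one_div_le_one_div_of_le (by positivity) (pow_le_pow_right₀ (by norm_num) h)

end PolyTimeReal

end PostTM

/-! ### Machines driven by random bits, and their runs. -/

namespace PostTM

/-- A machine that takes its steps according to a function of the state, the scanned symbols and
`m` fresh random bits. -/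
structure StepMachine (α : Type*) (Δ : Type) (m : ℕ) where
  Q : Type
  Γ : Type
  [fintypeQ : Fintype Q]
  [fintypeΓ : Fintype Γ]
  blank : Γ
  start : Q
  outcome : Q → Option Δ
  step : Q → InputSymbol α → Γ → Fin (2 ^ m) → Q × Move × Γ × Move

attribute [instance] StepMachine.fintypeQ StepMachine.fintypeΓ

/-- Moves past the end-markers are suppressed. -/
def clampMove {α : Type*} : InputSymbol α → Move → Move
  | .leftEnd, .left => .stay
  | .rightEnd, .right => .stay
  | _, d => d

namespace StepMachine

variable {α : Type*} {Δ : Type} {m : ℕ}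

/-- The action performed when the current random bits are `q.2` and the next ones are `r`. -/
def act (S : StepMachine α Δ m) (q : S.Q × Fin (2 ^ m)) (σ : InputSymbol α) (γ : S.Γ)
    (r : Fin (2 ^ m)) : (S.Q × Fin (2 ^ m)) × Move × S.Γ × Move :=
  (((S.step q.1 σ γ q.2).1, r), clampMove σ (S.step q.1 σ γ q.2).2.1,
    (S.step q.1 σ γ q.2).2.2.1, (S.step q.1 σ γ q.2).2.2.2)

/-- The next bits are stored in the new state, so different draws never lead to the same action.
Every transition probability is thus `0` or exactly `1 / 2 ^ m`. -/
theorem act_injective (S : StepMachine α Δ m) (q : S.Q × Fin (2 ^ m)) (σ : InputSymbol α)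
    (γ : S.Γ) : Function.Injective (S.act q σ γ) := by
  intro r r' h
  simpa [act] using h

open Classical in
/-- The probabilistic Turing machine that draws its random bits one step ahead. -/
noncomputable def toMachine (S : StepMachine α Δ m) : Machine α Δ where
  Q := S.Q × Fin (2 ^ m)
  Γ := S.Γ
  blank := S.blank
  -- The bits of the very first step are fixed, not drawn. Hence the condition `ρ 0 = 0` on runs.
  start := (S.start, 0)
  outcome q := S.outcome q.1
  δ q σ γ a := ∑ r, if a = S.act q σ γ r then 1 / 2 ^ m else 0
  δ_polyTime q σ γ a := by
    by_cases h : ∃ r, a = S.act q σ γ r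
    · obtain ⟨r, rfl⟩ := h
      simp only [(S.act_injective q σ γ).eq_iff, Finset.sum_ite_eq, Finset.mem_univ, if_true]
      exact polyTimeReal_two_pow _
    · push Not at h
      simp only [h, if_false, Finset.sum_const_zero]
      exact polyTimeReal_zero
  δ_sum q σ γ := by
    rw [Finset.sum_comm]
    simp
  δ_leftEnd q γ q' γ' d := by
    refine Finset.sum_eq_zero fun r _ => if_neg fun h => ?_
    have : Move.left = clampMove (.leftEnd : InputSymbol α) _ := congrArg (·.2.1) h
    revert this
    generalize (S.step q.1 .leftEnd γ q.2).2.1 = e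
    cases e <;> simp [clampMove]
  δ_rightEnd q γ q' γ' d := by
    refine Finset.sum_eq_zero fun r _ => if_neg fun h => ?_
    have : Move.right = clampMove (.rightEnd : InputSymbol α) _ := congrArg (·.2.1) h
    revert this
    generalize (S.step q.1 .rightEnd γ q.2).2.1 = e
    cases e <;> simp [clampMove]

/-- A configuration, without the random bits. -/
@[ext]
structure Cfg (S : StepMachine α Δ m) where
  state : S.Q
  inputPos : ℕ
  workPos : ℤ
  work : ℤ → S.Γ

/-- The configuration of the probabilistic machine, with random bits `r`. -/
def Cfg.withRand {S : StepMachine α Δ m} (c : S.Cfg) (r : Fin (2 ^ m)) : S.toMachine.Config :=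
  ⟨(c.state, r), c.inputPos, c.workPos, c.work⟩

/-- The action performed in configuration `c` with random bits `r`. -/
def action (S : StepMachine α Δ m) (w : List α) (c : S.Cfg) (r : Fin (2 ^ m)) :
    S.Q × Move × S.Γ × Move :=
  S.step c.state (inputAt w c.inputPos) (c.work c.workPos) r

/-- The next configuration. -/
def nextCfg (S : StepMachine α Δ m) (w : List α) (c : S.Cfg) (r : Fin (2 ^ m)) : S.Cfg :=
  ⟨(S.action w c r).1,
    Machine.moveInput c.inputPos (clampMove (inputAt w c.inputPos) (S.action w c r).2.1),
    Machine.moveWork c.workPos (S.action w c r).2.2.2,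
    Function.update c.work c.workPos (S.action w c r).2.2.1⟩

/-- The run of the machine on a given sequence of random bits, which is continued after halting. -/
def run (S : StepMachine α Δ m) (w : List α) (ρ : ℕ → Fin (2 ^ m)) : ℕ → S.Cfg
  | 0 => ⟨S.start, 0, 0, fun _ => S.blank⟩
  | k + 1 => S.nextCfg w (run S w ρ k) (ρ k)

/-- The run has not halted in the first `k` steps, the configuration after them excluded. -/
def Running (S : StepMachine α Δ m) (w : List α) (ρ : ℕ → Fin (2 ^ m)) (k : ℕ) : Prop :=
  ∀ i < k, S.outcome (S.run w ρ i).state = none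

variable {S : StepMachine α Δ m} {w : List α} {ρ ρ' : ℕ → Fin (2 ^ m)} {k : ℕ}

theorem run_congr (h : ∀ i < k, ρ i = ρ' i) : S.run w ρ k = S.run w ρ' k := by
  induction k with
  | zero => rfl
  | succ k ih => rw [run, run, ih fun i hi => h i (by lia), h k (by lia)]

theorem Running.congr (h : ∀ i < k, ρ i = ρ' i) (hr : S.Running w ρ k) : S.Running w ρ' k := by
  intro i hi
  rw [← run_congr fun j hj => h j (by lia)]
  exact hr i hi

theorem Running.succ (hr : S.Running w ρ k) (h : S.outcome (S.run w ρ k).state = none) :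
    S.Running w ρ (k + 1) := by
  intro i hi
  rcases Nat.lt_succ_iff_lt_or_eq.1 hi with hi | rfl
  · exact hr i hi
  · exact h

theorem Running.mono {l : ℕ} (hr : S.Running w ρ k) (h : l ≤ k) : S.Running w ρ l :=
  fun i hi => hr i (by lia)

theorem next_withRand (c : S.Cfg) (r r' : Fin (2 ^ m)) :
    S.toMachine.next (c.withRand r) (S.act (c.state, r) (inputAt w c.inputPos) (c.work c.workPos) r')
      = (S.nextCfg w c r).withRand r' := rfl

open Classical in
theorem prob_withRand (c : S.Cfg) (r : Fin (2 ^ m))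
    (a : (S.Q × Fin (2 ^ m)) × Move × S.Γ × Move) :
    S.toMachine.prob w (c.withRand r) a = ∑ r', if a = S.act (c.state, r) (inputAt w c.inputPos)
      (c.work c.workPos) r' then 1 / 2 ^ m else 0 := rfl

theorem prob_withRand_pos (c : S.Cfg) (r : Fin (2 ^ m))
    (a : (S.Q × Fin (2 ^ m)) × Move × S.Γ × Move) :
    0 < S.toMachine.prob w (c.withRand r) a ↔
      ∃ r', a = S.act (c.state, r) (inputAt w c.inputPos) (c.work c.workPos) r' := by
  classical
  rw [prob_withRand]
  constructor
  · intro h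
    by_contra! hn
    simp [hn] at h
  · rintro ⟨r', rfl⟩
    simp [(S.act_injective _ _ _).eq_iff]

theorem reachedIn_withRand_run (h0 : ρ 0 = 0) (hr : S.Running w ρ k) :
    S.toMachine.ReachedIn w k ((S.run w ρ k).withRand (ρ k)) := by
  induction k with
  | zero =>
    rw [h0]
    exact Machine.ReachedIn.init
  | succ k ih =>
    exact Machine.ReachedIn.step (ih (hr.mono (by lia))) (hr k (by lia))
      ((prob_withRand_pos _ _ _).2 ⟨ρ (k + 1), rfl⟩)

/-- A path of nonzero probability is a choice of one draw per step; the draws after its end can be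
chosen freely. With `reachedIn_withRand_run` this replaces reachability by deterministic runs on bit
sequences. -/
theorem exists_run_of_reachedIn {c : S.toMachine.Config} (h : S.toMachine.ReachedIn w k c) :
    ∃ ρ, ρ 0 = 0 ∧ S.Running w ρ k ∧ c = (S.run w ρ k).withRand (ρ k) := by
  induction h with
  | init => exact ⟨fun _ => 0, rfl, fun i hi => by lia, rfl⟩
  | @step k c a hc ho hp ih =>
    obtain ⟨ρ, h0, hr, rfl⟩ := ih
    obtain ⟨r', rfl⟩ := (prob_withRand_pos _ _ _).1 hp
    have hcongr : ∀ i < k + 1, ρ i = Function.update ρ (k + 1) r' i := fun i hi => by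
      rw [Function.update_of_ne (by lia)]
    refine ⟨Function.update ρ (k + 1) r', ?_, (hr.succ ho).congr hcongr, ?_⟩
    · rw [← hcongr 0 (by lia), h0]
    · rw [next_withRand (w := w), ← run_congr hcongr, Function.update_self]
      rfl

theorem sum_sum_ite_mul {ι A : Type*} [Fintype ι] [Fintype A] [DecidableEq A] (g : ι → A) (b : ℝ)
    (F : A → ℝ) : ∑ a, (∑ i, if a = g i then b else 0) * F a = ∑ i, b * F (g i) := by
  simp only [Finset.sum_mul]
  rw [Finset.sum_comm]
  simp

section Probability

variable [DecidableEq Δ]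

theorem haltProbWithin_succ (c : S.Cfg) (r : Fin (2 ^ m)) (o : Δ) (k : ℕ)
    (h : S.outcome c.state = none) :
    S.toMachine.haltProbWithin w o (k + 1) (c.withRand r) =
      ∑ r', 1 / 2 ^ m * S.toMachine.haltProbWithin w o k ((S.nextCfg w c r).withRand r') := by
  classical
  have ho : S.toMachine.outcome (c.withRand r).state = none := h
  rw [Machine.haltProbWithin]
  rw [ho]
  dsimp only
  exact sum_sum_ite_mul (S.act (c.state, r) (inputAt w c.inputPos) (c.work c.workPos))
    (1 / 2 ^ m) fun a => S.toMachine.haltProbWithin w o k (S.toMachine.next (c.withRand r) a)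

end Probability

end StepMachine

/-! ### Halting probabilities and reachability. -/

namespace Machine

variable {α : Type*} {Δ : Type} [DecidableEq Δ] (M : Machine α Δ) (w : List α) (o : Δ)

omit [DecidableEq Δ] in
theorem prob_nonneg (c : M.Config) (r : M.Q × Move × M.Γ × Move) : 0 ≤ M.prob w c r :=
  (M.δ_polyTime _ _ _ _).1

theorem haltProbWithin_nonneg (k : ℕ) (c : M.Config) : 0 ≤ M.haltProbWithin w o k c := by
  induction k generalizing c with
  | zero => rw [haltProbWithin]; split_ifs <;> norm_num
  | succ k ih =>
    rw [haltProbWithin]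
    split
    · split_ifs <;> norm_num
    · exact Finset.sum_nonneg fun r _ => mul_nonneg (M.prob_nonneg w c r) (ih _)

theorem haltProbWithin_le_one (k : ℕ) (c : M.Config) : M.haltProbWithin w o k c ≤ 1 := by
  induction k generalizing c with
  | zero => rw [haltProbWithin]; split_ifs <;> norm_num
  | succ k ih =>
    rw [haltProbWithin]
    split
    · split_ifs <;> norm_num
    · refine (Finset.sum_le_sum fun r _ =>
        mul_le_of_le_one_right (M.prob_nonneg w c r) (ih _)).trans ?_
      exact (M.δ_sum _ _ _).le

theorem bddAbove_haltProbWithin :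
    BddAbove (Set.range fun k => M.haltProbWithin w o k M.init) :=
  ⟨1, by rintro _ ⟨k, rfl⟩; exact M.haltProbWithin_le_one w o k _⟩

theorem haltProbWithin_le_haltProb (k : ℕ) : M.haltProbWithin w o k M.init ≤ M.haltProb w o :=
  le_ciSup (M.bddAbove_haltProbWithin w o) k

variable {M w o} in
theorem exists_reachedIn_of_haltProbWithin_pos {j k : ℕ} {c : M.Config} (hc : M.ReachedIn w j c)
    (h : 0 < M.haltProbWithin w o k c) :
    ∃ k c, M.ReachedIn w k c ∧ M.outcome c.state = some o := by
  induction k generalizing j c with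
  | zero =>
    rw [haltProbWithin] at h
    split_ifs at h with ho
    · exact ⟨j, c, hc, ho⟩
    · exact absurd h (lt_irrefl _)
  | succ k ih =>
    rcases ho : M.outcome c.state with _ | o'
    · rw [haltProbWithin, ho] at h
      obtain ⟨r, -, hr⟩ := Finset.exists_lt_of_sum_lt
        (by simpa using h : ∑ r : M.Q × Move × M.Γ × Move, (0 : ℝ) < _)
      have hp : 0 < M.prob w c r := (M.prob_nonneg w c r).lt_of_ne fun h0 => by
        rw [← h0, zero_mul] at hr
        exact lt_irrefl _ hr
      exact ih (hc.step ho hp) (pos_of_mul_pos_right hr hp.le)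
    · rw [haltProbWithin, ho] at h
      dsimp only at h
      split_ifs at h with h1
      · exact ⟨j, c, hc, h1 ▸ ho⟩
      · exact absurd h (lt_irrefl _)

variable {M w o} in
theorem haltProbWithin_init_pos {j k : ℕ} {c : M.Config} (hc : M.ReachedIn w j c)
    (h : 0 < M.haltProbWithin w o k c) : 0 < M.haltProbWithin w o (k + j) M.init := by
  induction hc generalizing k with
  | init => exact h
  | @step j c r hc ho hp ih =>
    rw [show k + (j + 1) = (k + 1) + j by lia]
    refine ih ?_
    rw [haltProbWithin, ho]
    exact (mul_pos hp h).trans_le (Finset.single_le_sum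
      (f := fun r => M.prob w c r * M.haltProbWithin w o k (M.next c r))
      (fun r _ => mul_nonneg (M.prob_nonneg w c r) (M.haltProbWithin_nonneg w o k _))
      (Finset.mem_univ r))

/-- A positive supremum is already positive at some finite step bound, and a finite path multiplies
finitely many positive probabilities. This turns cutpoint zero into nondeterministic acceptance. -/
theorem haltProb_pos_iff :
    0 < M.haltProb w o ↔ ∃ k c, M.ReachedIn w k c ∧ M.outcome c.state = some o := by
  constructor
  · intro h
    obtain ⟨k, hk⟩ := exists_lt_of_lt_ciSup h
    exact exists_reachedIn_of_haltProbWithin_pos ReachedIn.init hk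
  · rintro ⟨k, c, hc, ho⟩
    refine (haltProbWithin_init_pos (k := 0) hc ?_).trans_le (M.haltProbWithin_le_haltProb w o _)
    rw [haltProbWithin, if_pos ho]
    exact one_pos

theorem haltProb_nonneg : 0 ≤ M.haltProb w o :=
  (M.haltProbWithin_nonneg w o 0 _).trans (M.haltProbWithin_le_haltProb w o 0)

end Machine

/-! ### Bounds on the probability of halting. -/

namespace StepMachine

variable {α : Type*} {Δ : Type} {m : ℕ} {S : StepMachine α Δ m} {w : List α} {ρ : ℕ → Fin (2 ^ m)}
  [DecidableEq Δ]

/-- In each average over the next draw only the term of the given run is kept, at the cost of a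
factor `1 / 2 ^ m`. -/
theorem le_haltProbWithin_run {o : Δ} (k j : ℕ) (hr : S.Running w ρ (j + k))
    (ho : S.outcome (S.run w ρ (j + k)).state = some o) :
    (1 / 2 ^ m : ℝ) ^ k ≤
      S.toMachine.haltProbWithin w o k ((S.run w ρ j).withRand (ρ j)) := by
  induction k generalizing j with
  | zero =>
    have : S.toMachine.outcome ((S.run w ρ j).withRand (ρ j)).state = some o := ho
    rw [Machine.haltProbWithin, if_pos this, pow_zero]
  | succ k ih =>
    rw [haltProbWithin_succ _ _ _ _ (hr j (by lia)), pow_succ']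
    have h1 := ih (j + 1) (by convert hr using 1; lia) (by convert ho using 4; lia)
    refine (mul_le_mul_of_nonneg_left h1 (by positivity)).trans ?_
    exact Finset.single_le_sum (f := fun r' => 1 / 2 ^ m *
      S.toMachine.haltProbWithin w o k ((S.nextCfg w (S.run w ρ j) (ρ j)).withRand r'))
      (fun r _ => mul_nonneg (by positivity) (Machine.haltProbWithin_nonneg _ _ _ _ _))
      (Finset.mem_univ (ρ (j + 1)))

theorem le_haltProb {o : Δ} {k : ℕ} (h0 : ρ 0 = 0) (hr : S.Running w ρ k)
    (ho : S.outcome (S.run w ρ k).state = some o) :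
    (1 / 2 ^ m : ℝ) ^ k ≤ S.toMachine.haltProb w o := by
  have := le_haltProbWithin_run k 0 (by simpa using hr) (by simpa using ho)
  rw [h0] at this
  exact this.trans (S.toMachine.haltProbWithin_le_haltProb w o k)

open Classical in
/-- A bound on the probability of a single way of halting that takes at least `X` steps and needs
the first `X` draws to vanish, given the draws up to time `j`. -/
noncomputable def zeroBound (X : ℕ) (ρ : ℕ → Fin (2 ^ m)) (j : ℕ) : ℝ :=
  if ∀ i ≤ j, i < X → ρ i = 0 then (1 / 2 ^ m) ^ (X - 1 - j) else 0

omit [DecidableEq Δ] in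
theorem zeroBound_nonneg (X : ℕ) (ρ : ℕ → Fin (2 ^ m)) (j : ℕ) : 0 ≤ zeroBound X ρ j := by
  unfold zeroBound
  split_ifs <;> positivity

omit [DecidableEq Δ] in
-- `zeroBound` is a supermartingale: while `j + 1 < X`, only the draw `0` survives and the exponent
-- drops by one; afterwards no draw is constrained any more.
theorem sum_zeroBound_le (X : ℕ) (ρ : ℕ → Fin (2 ^ m)) (j : ℕ) :
    ∑ r, 1 / 2 ^ m * zeroBound X (Function.update ρ (j + 1) r) (j + 1) ≤ zeroBound X ρ j := by
  have hiff : ∀ r, (∀ i ≤ j + 1, i < X → Function.update ρ (j + 1) r i = 0) ↔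
      (∀ i ≤ j, i < X → ρ i = 0) ∧ (j + 1 < X → r = 0) := by
    intro r
    constructor
    · refine fun h => ⟨fun i hi hX => ?_, fun hX => ?_⟩
      · have := h i (by lia) hX
        rwa [Function.update_of_ne (by lia)] at this
      · simpa using h (j + 1) le_rfl hX
    · rintro ⟨h1, h2⟩ i hi hX
      rcases Nat.lt_or_ge i (j + 1) with h | h
      · rw [Function.update_of_ne (by lia)]
        exact h1 i (by lia) hX
      · obtain rfl : i = j + 1 := by lia
        rw [Function.update_self]
        exact h2 hX
  unfold zeroBound
  simp only [hiff]
  by_cases hz : ∀ i ≤ j, i < X → ρ i = 0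
  · rw [if_pos hz]
    by_cases hX : j + 1 < X
    · rw [Finset.sum_eq_single 0]
      · rw [if_pos ⟨hz, fun _ => rfl⟩, ← pow_succ', show X - 1 - (j + 1) + 1 = X - 1 - j by lia]
      · intro r _ hr
        rw [if_neg fun h => hr (h.2 hX), mul_zero]
      · intro h
        exact absurd (Finset.mem_univ _) h
    · rw [Finset.sum_congr rfl fun r _ => by rw [if_pos ⟨hz, fun h => absurd h hX⟩],
        show X - 1 - (j + 1) = 0 by lia, show X - 1 - j = 0 by lia]
      simp
  · rw [if_neg hz, Finset.sum_eq_zero]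
    intro r _
    rw [if_neg fun h => hz h.1, mul_zero]

/-- At a halt with outcome `o` the bound equals `1`, and elsewhere it is a nonnegative
supermartingale, so it dominates the halting probability by induction on the remaining steps. -/
theorem haltProbWithin_run_le {o : Δ} {X : ℕ}
    (H : ∀ ρ k, S.Running w ρ k → S.outcome (S.run w ρ k).state = some o →
      ρ 0 = 0 → X ≤ k ∧ ∀ i < X, ρ i = 0)
    (k j : ℕ) (ρ : ℕ → Fin (2 ^ m)) (h0 : ρ 0 = 0) (hr : S.Running w ρ j) :
    S.toMachine.haltProbWithin w o k ((S.run w ρ j).withRand (ρ j)) ≤ zeroBound X ρ j := by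
  have hhalt : S.outcome (S.run w ρ j).state = some o → (1 : ℝ) ≤ zeroBound X ρ j := by
    intro ho
    obtain ⟨h1, h2⟩ := H ρ j hr ho h0
    rw [zeroBound, if_pos fun i _ hi => h2 i hi, Nat.sub_eq_zero_of_le (by lia), pow_zero]
  have hstate : S.toMachine.outcome ((S.run w ρ j).withRand (ρ j)).state =
    S.outcome (S.run w ρ j).state := rfl
  induction k generalizing j ρ with
  | zero =>
    rw [Machine.haltProbWithin, hstate]
    split_ifs with h1
    · exact hhalt h1
    · exact zeroBound_nonneg _ _ _
  | succ k ih =>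
    rcases hs : S.outcome (S.run w ρ j).state with _ | o'
    · rw [haltProbWithin_succ _ _ _ _ hs]
      refine (Finset.sum_le_sum fun r _ => mul_le_mul_of_nonneg_left ?_ (by positivity)).trans
        (sum_zeroBound_le X ρ j)
      have hcongr : ∀ i < j + 1, ρ i = Function.update ρ (j + 1) r i := fun i hi => by
        rw [Function.update_of_ne (by lia)]
      have h0' : Function.update ρ (j + 1) r 0 = 0 := by rw [← hcongr 0 (by lia), h0]
      have hr' := (hr.succ hs).congr hcongr
      have := ih (j + 1) (Function.update ρ (j + 1) r) h0' hr'
        (by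
          intro ho
          obtain ⟨h1, h2⟩ := H _ _ hr' ho h0'
          rw [zeroBound, if_pos fun i _ hi => h2 i hi, Nat.sub_eq_zero_of_le (by lia), pow_zero])
        rfl
      rwa [← run_congr hcongr, Function.update_self] at this
    · rw [Machine.haltProbWithin, hstate, hs]
      dsimp only
      split_ifs with h1
      · exact hhalt (h1 ▸ hs)
      · exact zeroBound_nonneg _ _ _

/-- The exponent is `X - 1` because the first of the `X` vanishing draws is fixed in advance. -/
theorem haltProb_le {o : Δ} {X : ℕ}
    (H : ∀ ρ k, S.Running w ρ k → S.outcome (S.run w ρ k).state = some o →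
      ρ 0 = 0 → X ≤ k ∧ ∀ i < X, ρ i = 0) :
    S.toMachine.haltProb w o ≤ (1 / 2 ^ m : ℝ) ^ (X - 1) := by
  refine ciSup_le fun k => ?_
  refine (haltProbWithin_run_le H k 0 (fun _ => 0) rfl (fun i hi => by lia)).trans ?_
  simp [zeroBound]

end StepMachine

end PostTM

/-! ### Postselection: one-sided error from a timeout that is postselected only on zero bits. -/

namespace PostTM

namespace StepMachine

variable {α : Type*} {m : ℕ}

/-- Remember whether all random bits have vanished so far, and turn the halting outcome `true` into
postselected acceptance and `false` into postselected rejection, the latter only if they have. -/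
def withFlag (N : StepMachine α Bool m) : StepMachine α PostOutcome m where
  Q := N.Q × Bool
  Γ := N.Γ
  blank := N.blank
  start := (N.start, true)
  outcome q := (N.outcome q.1).map fun b =>
    if b then .postAccept else if q.2 then .postReject else .nonpost
  step q σ γ r := (((N.step q.1 σ γ r).1, q.2 && decide (r = 0)), (N.step q.1 σ γ r).2)

variable {N : StepMachine α Bool m} {w : List α} {ρ : ℕ → Fin (2 ^ m)} {k : ℕ}

theorem run_withFlag (w : List α) (ρ : ℕ → Fin (2 ^ m)) (k : ℕ) :
    N.withFlag.run w ρ k = ⟨((N.run w ρ k).state, decide (∀ i < k, ρ i = 0)),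
      (N.run w ρ k).inputPos, (N.run w ρ k).workPos, (N.run w ρ k).work⟩ := by
  induction k with
  | zero => simp [run, withFlag]
  | succ k ih =>
    rw [run, ih]
    have : decide (∀ i < k + 1, ρ i = 0) = (decide (∀ i < k, ρ i = 0) && decide (ρ k = 0)) := by
      rw [← Bool.decide_and, decide_eq_decide]
      exact Nat.forall_lt_succ_right
    rw [this]
    rfl

theorem outcome_run_withFlag (w : List α) (ρ : ℕ → Fin (2 ^ m)) (k : ℕ) :
    N.withFlag.outcome (N.withFlag.run w ρ k).state = (N.outcome (N.run w ρ k).state).map fun b =>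
      if b then .postAccept else if ∀ i < k, ρ i = 0 then .postReject else .nonpost := by
  rw [run_withFlag]
  simp [withFlag]

theorem running_withFlag : N.withFlag.Running w ρ k ↔ N.Running w ρ k := by
  refine forall₂_congr fun i _ => ?_
  rw [outcome_run_withFlag, Option.map_eq_none_iff]

/-- A machine every run of which on `w` either halts at time `X w` with outcome `false` or halts at
least two steps earlier with outcome `true`, the latter being possible exactly for the members of
`L`, gives rise to a machine with postselection for `L`. -/
theorem mem_PostRTISP {L : Language α} {T : Set (ℕ → ℕ)} {s t f : ℕ → ℕ} (N : StepMachine α Bool m)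
    (hbits : 1 ≤ m) (X : List α → ℕ) (ht : t ∈ T) (hf : IsBigONat f s)
    (hX : ∀ w, X w ≤ t w.length)
    (hhalt : ∀ w ρ, ∃ k b, N.Running w ρ k ∧ N.outcome (N.run w ρ k).state = some b ∧
      (b = true → k + 2 ≤ X w ∧ w ∈ L) ∧ (b = false → k = X w))
    (hmem : ∀ w ∈ L, ∃ ρ k, ρ 0 = 0 ∧ N.Running w ρ k ∧ N.outcome (N.run w ρ k).state = some true)
    (V : List α → Set ℤ) (hVf : ∀ w, (V w).encard ≤ (f w.length : ℕ∞))
    (hV : ∀ w ρ k, N.Running w ρ k → (N.run w ρ k).workPos ∈ V w) :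
    L ∈ PostRTISP α T s := by
  -- A run halts at one time only, so what `hhalt` says about some halting time holds for every one.
  have huniq : ∀ w ρ k b, N.Running w ρ k → N.outcome (N.run w ρ k).state = some b →
      (b = true → k + 2 ≤ X w ∧ w ∈ L) ∧ (b = false → k = X w) := by
    intro w ρ k b hr ho
    obtain ⟨k', b', hr', ho', h⟩ := hhalt w ρ
    rcases lt_trichotomy k k' with hlt | rfl | hlt
    · rw [hr' k hlt] at ho
      simp at ho
    · rw [ho'] at ho
      obtain rfl : b' = b := by simpa using ho
      exact h
    · rw [hr k' hlt] at ho'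
      simp at ho'
  have hacc_out : ∀ w ρ k, N.withFlag.outcome (N.withFlag.run w ρ k).state = some .postAccept →
      N.outcome (N.run w ρ k).state = some true := by
    intro w ρ k h
    rw [outcome_run_withFlag] at h
    rcases ho : N.outcome (N.run w ρ k).state with _ | b
    · simp [ho] at h
    · cases b
      · simp only [ho, Option.map_some, Option.some.injEq, Bool.false_eq_true, if_false] at h
        split_ifs at h
      · rfl
  have hrej_out : ∀ w ρ k, N.withFlag.outcome (N.withFlag.run w ρ k).state = some .postReject →
      N.outcome (N.run w ρ k).state = some false ∧ ∀ i < k, ρ i = 0 := by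
    intro w ρ k h
    rw [outcome_run_withFlag] at h
    rcases ho : N.outcome (N.run w ρ k).state with _ | b
    · simp [ho] at h
    · cases b
      · rw [ho] at h
        by_cases hz : ∀ i < k, ρ i = 0
        · exact ⟨rfl, hz⟩
        · simp [hz] at h
      · simp [ho] at h
  set β : ℝ := 1 / 2 ^ m with hβ
  have hβ0 : 0 < β := by positivity
  have hβ2 : β ≤ 1 / 2 := by
    refine one_div_le_one_div_of_le (by norm_num) ?_
    calc (2 : ℝ) = 2 ^ 1 := by norm_num
      _ ≤ 2 ^ m := pow_le_pow_right₀ (by norm_num) hbits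
  set M := N.withFlag.toMachine with hM
  have hrej_le : ∀ w, M.haltProb w .postReject ≤ β ^ (X w - 1) := by
    intro w
    refine haltProb_le fun ρ k hr ho _ => ?_
    obtain ⟨h1, h2⟩ := hrej_out w ρ k ho
    have := (huniq w ρ k false (running_withFlag.1 hr) h1).2 rfl
    exact ⟨this.ge, fun i hi => h2 i (by lia)⟩
  have hacc_mem : ∀ w ∈ L, ∃ k, k + 2 ≤ X w ∧ β ^ k ≤ M.haltProb w .postAccept := by
    intro w hw
    obtain ⟨ρ, k, h0, hr, ho⟩ := hmem w hw
    refine ⟨k, ((huniq w ρ k true hr ho).1 rfl).1,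
      le_haltProb (S := N.withFlag) h0 (running_withFlag.2 hr) ?_⟩
    rw [outcome_run_withFlag, ho]
    rfl
  have hacc_not : ∀ w ∉ L, M.haltProb w .postAccept = 0 := by
    intro w hw
    refine le_antisymm (not_lt.1 fun h => ?_) (M.haltProb_nonneg _ _)
    obtain ⟨k, c, hc, ho⟩ := (M.haltProb_pos_iff _ _).1 h
    obtain ⟨ρ, h0, hr, rfl⟩ := exists_run_of_reachedIn hc
    exact hw ((huniq w ρ k true (running_withFlag.1 hr) (hacc_out w ρ k ho)).1 rfl).2
  have hrej_not : ∀ w ∉ L, 0 < M.haltProb w .postReject := by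
    intro w hw
    -- For a nonmember the all-zero run cannot accept, so it times out with its flag still set and
    -- supplies the postselected rejection.
    obtain ⟨k, b, hr, ho, h1, h2⟩ := hhalt w fun _ => 0
    have hb : b = false := by
      by_contra hb
      exact hw (h1 (by simpa using hb)).2
    subst hb
    refine (by positivity : 0 < β ^ k).trans_le
      (le_haltProb (S := N.withFlag) (ρ := fun _ => 0) rfl (running_withFlag.2 hr) ?_)
    rw [outcome_run_withFlag, ho]
    simp
  have hmem_pos : ∀ w ∈ L, 0 < M.haltProb w .postAccept := by
    intro w hw
    obtain ⟨k, -, hk⟩ := hacc_mem w hw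
    exact (by positivity : 0 < β ^ k).trans_le hk
  let P : PostPTM α := ⟨M, fun w => by
    by_cases hw : w ∈ L
    · exact add_pos_of_pos_of_nonneg (hmem_pos w hw) (M.haltProb_nonneg _ _)
    · exact add_pos_of_nonneg_of_pos (M.haltProb_nonneg _ _) (hrej_not w hw)⟩
  -- Rejection being at most half as likely as acceptance, members are accepted with overall
  -- probability at least `2/3`.
  refine ⟨P, t, f, ht, hf, ?_, ?_, ?_, 1 / 3, by norm_num, by norm_num, ?_, ?_⟩
  · intro w k c hc ho
    obtain ⟨ρ, h0, hr, rfl⟩ := exists_run_of_reachedIn hc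
    have hr' := (running_withFlag.1 (hr.succ ho))
    obtain ⟨k', b, -, ho', h1, h2⟩ := hhalt w ρ
    have : k < k' := by
      by_contra hlt
      rw [hr' k' (by lia)] at ho'
      simp at ho'
    refine lt_of_lt_of_le ?_ (hX w)
    cases b
    · have := h2 rfl; lia
    · have := (h1 rfl).1; lia
  · intro w
    refine (Set.encard_le_encard ?_).trans (hVf w)
    rintro z ⟨k, c, hc, rfl⟩
    obtain ⟨ρ, h0, hr, rfl⟩ := exists_run_of_reachedIn hc
    have := hV w ρ k (running_withFlag.1 hr)
    rw [run_withFlag]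
    exact this
  · intro w
    constructor
    · intro hw
      exact div_pos (hmem_pos w hw) (P.post_pos w)
    · intro h
      by_contra hw
      have : P.acceptProb w = 0 := by
        rw [PostPTM.acceptProb]
        exact (congrArg (· / _) (hacc_not w hw)).trans (zero_div _)
      exact h.ne' this
  · intro w hw
    obtain ⟨k, hk, hak⟩ := hacc_mem w hw
    -- The two steps by which acceptance precedes `X w` are needed here: one is lost to the fixed
    -- first draw, the other gives the factor `β ≤ 1/2`.
    have h2 : M.haltProb w .postReject ≤ M.haltProb w .postAccept / 2 := by
      calc M.haltProb w .postReject ≤ β ^ (X w - 1) := hrej_le w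
        _ ≤ β ^ (k + 1) := pow_le_pow_of_le_one hβ0.le (by linarith) (by lia)
        _ = β ^ k * β := pow_succ _ _
        _ ≤ β ^ k * (1 / 2) := by gcongr
        _ ≤ M.haltProb w .postAccept / 2 := by linarith
    refine (le_div_iff₀ (P.post_pos w)).2 ?_
    change _ * (M.haltProb w .postAccept + M.haltProb w .postReject) ≤ M.haltProb w .postAccept
    linarith
  · intro w hw
    have : P.rejectProb w = 1 := by
      change M.haltProb w .postReject / (M.haltProb w .postAccept + M.haltProb w .postReject) = 1
      rw [hacc_not w hw, zero_add, div_self (hrej_not w hw).ne']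
    rw [this]
    norm_num

end StepMachine

end PostTM

/-! ### Visited cells, counting configurations, deterministic runs. -/

namespace PostTM

open Filter Asymptotics

/-- The finitely many values before the asymptotic bound sets in are absorbed into the constant,
which is possible because `v ≥ 1`. -/
theorem exists_le_mul_of_isBigONat {g s v : ℕ → ℕ} (h : IsBigONat g s) (hs : ∀ n, s n ≤ v n)
    (hv : ∀ n, 1 ≤ v n) : ∃ C, ∀ n, g n ≤ C * v n := by
  obtain ⟨c, hc⟩ := h.bound
  obtain ⟨n₀, hn₀⟩ := eventually_atTop.1 hc
  refine ⟨⌈c⌉₊ + ∑ i ∈ Finset.range n₀, g i, fun n => ?_⟩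
  rcases lt_or_ge n n₀ with hn | hn
  · calc g n ≤ ∑ i ∈ Finset.range n₀, g i :=
        Finset.single_le_sum (f := g) (fun _ _ => Nat.zero_le _) (Finset.mem_range.2 hn)
      _ ≤ (⌈c⌉₊ + ∑ i ∈ Finset.range n₀, g i) * 1 := by lia
      _ ≤ _ := Nat.mul_le_mul_left _ (hv n)
  · have h1 := hn₀ n hn
    rw [Real.norm_natCast, Real.norm_natCast] at h1
    have h2 : (g n : ℝ) ≤ (⌈c⌉₊ * s n : ℕ) := by
      push_cast
      exact h1.trans (mul_le_mul_of_nonneg_right (Nat.le_ceil c) (Nat.cast_nonneg _))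
    have h3 : g n ≤ ⌈c⌉₊ * s n := by exact_mod_cast h2
    calc g n ≤ ⌈c⌉₊ * s n := h3
      _ ≤ ⌈c⌉₊ * v n := Nat.mul_le_mul_left _ (hs n)
      _ ≤ _ := Nat.mul_le_mul_right _ (by lia)

/-- A path with steps of size at most one skips no integer, so each new position is in the interval
visited so far or extends it by one cell. -/
theorem exists_Ico_eq_path {p : ℕ → ℤ} {k : ℕ} (h : ∀ i < k, |p (i + 1) - p i| ≤ 1) :
    ∃ (lo : ℤ) (v : ℕ), ∀ z, (∃ i ≤ k, p i = z) ↔ lo ≤ z ∧ z < lo + v := by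
  induction k with
  | zero =>
    refine ⟨p 0, 1, fun z => ⟨?_, fun hz => ⟨0, le_rfl, by lia⟩⟩⟩
    rintro ⟨i, hi, rfl⟩
    obtain rfl : i = 0 := by lia
    lia
  | succ k ih =>
    obtain ⟨lo, v, hlo⟩ := ih fun i hi => h i (by lia)
    have hk := (hlo (p k)).1 ⟨k, le_rfl, rfl⟩
    have hstep := abs_le.1 (h k (by lia))
    have hsplit : ∀ z, (∃ i ≤ k + 1, p i = z) ↔ (lo ≤ z ∧ z < lo + v) ∨ p (k + 1) = z := by
      intro z
      rw [← hlo]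
      constructor
      · rintro ⟨i, hi, rfl⟩
        rcases Nat.lt_or_ge i (k + 1) with h | h
        · exact Or.inl ⟨i, by lia, rfl⟩
        · exact Or.inr (by rw [show i = k + 1 by lia])
      · rintro (⟨i, hi, rfl⟩ | rfl)
        · exact ⟨i, by lia, rfl⟩
        · exact ⟨k + 1, le_rfl, rfl⟩
    simp only [hsplit]
    by_cases h1 : p (k + 1) < lo
    · exact ⟨lo - 1, v + 1, fun z => by push_cast; lia⟩
    · by_cases h2 : p (k + 1) < lo + v
      · exact ⟨lo, v, fun z => by lia⟩
      · exact ⟨lo, v + 1, fun z => by push_cast; lia⟩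

namespace Machine

variable {α : Type*} {Δ : Type} {M : Machine α Δ} {w : List α}

theorem inputAt_length_add_one (w : List α) : inputAt w (w.length + 1) = .rightEnd := by
  simp [inputAt]

theorem ReachedIn.inputPos_le {k : ℕ} {c : M.Config} (h : M.ReachedIn w k c) :
    c.inputPos ≤ w.length + 1 := by
  induction h with
  | init => exact Nat.zero_le _
  | @step k c r hc ho hp ih =>
    obtain ⟨q, d, γ, d'⟩ := r
    rcases d with _ | _ | _
    · simp only [next, moveInput]; lia
    · rcases ih.lt_or_eq with hlt | heq
      · simp only [next, moveInput]; lia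
      · rw [prob, heq, inputAt_length_add_one, M.δ_rightEnd] at hp
        exact absurd hp (lt_irrefl _)
    · simpa only [next, moveInput] using ih

theorem abs_moveWork_sub_le (z : ℤ) (d : Move) : |moveWork z d - z| ≤ 1 := by
  cases d <;> simp [moveWork]

theorem ReachedIn.workPos_mem {k : ℕ} {c : M.Config} (h : M.ReachedIn w k c) :
    c.workPos ∈ M.visited w := ⟨k, c, h, rfl⟩

theorem ReachedIn.work_eq_blank {k : ℕ} {c : M.Config} (h : M.ReachedIn w k c) {z : ℤ}
    (hz : z ∉ M.visited w) : c.work z = M.blank := by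
  induction h with
  | init => rfl
  | @step k c r hc ho hp ih =>
    refine (Function.update_of_ne ?_ _ _).trans ih
    rintro rfl
    exact hz hc.workPos_mem

theorem ReachedIn.uIcc_subset {k : ℕ} {c : M.Config} (h : M.ReachedIn w k c) :
    Set.uIcc 0 c.workPos ⊆ M.visited w := by
  induction h with
  | init =>
    intro z hz
    obtain rfl : z = 0 := by simpa [Machine.init] using hz
    exact ReachedIn.init.workPos_mem
  | @step k c r hc ho hp ih =>
    intro z hz
    by_cases hz' : z = (M.next c r).workPos
    · subst hz'
      exact (ReachedIn.step hc ho hp).workPos_mem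
    · apply ih
      have := abs_le.1 (abs_moveWork_sub_le c.workPos r.2.2.2)
      have e : (M.next c r).workPos = moveWork c.workPos r.2.2.2 := rfl
      rw [Set.mem_uIcc] at hz ⊢
      lia

/-- The two cells may be visited on different branches, but both branches start at cell `0`, so
every cell between them is visited too. Consequently all cells at distance at least `f` from a
reachable head position are blank. -/
theorem abs_sub_lt_of_mem_visited {f : ℕ} (hf : (M.visited w).encard ≤ (f : ℕ∞)) {x y : ℤ}
    (hx : x ∈ M.visited w) (hy : y ∈ M.visited w) : |x - y| < f := by
  have hsub : Set.uIcc x y ⊆ M.visited w := by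
    obtain ⟨k, c, hc, rfl⟩ := hx
    obtain ⟨k', c', hc', rfl⟩ := hy
    intro z hz
    by_cases h : z ∈ Set.uIcc 0 c.workPos
    · exact hc.uIcc_subset h
    · apply hc'.uIcc_subset
      rw [Set.mem_uIcc] at *
      lia
  have h1 := (Set.encard_le_encard hsub).trans hf
  have h2 : (Set.uIcc x y).encard = ((Finset.uIcc x y).card : ℕ∞) := by
    rw [← Finset.coe_uIcc, Set.encard_coe_eq_coe_finsetCard]
  rw [h2, Int.card_uIcc] at h1
  have h3 : (y - x).natAbs + 1 ≤ f := by exact_mod_cast h1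
  rw [abs_lt]
  lia

/-- A bound on the number of configurations on inputs of length `n` when `f` cells are used. -/
def configBound (M : Machine α Δ) (n f : ℕ) : ℕ :=
  Fintype.card M.Q * ((n + 2) * (f * Fintype.card M.Γ ^ f))

/-- Cells that are never visited stay blank, so a reachable configuration is determined by its
state, its two head positions and the visited part of its tape. -/
theorem encard_reached_le {f : ℕ} (hf : (M.visited w).encard ≤ (f : ℕ∞)) :
    {c | ∃ k, M.ReachedIn w k c}.encard ≤ (M.configBound w.length f : ℕ∞) := by
  classical
  have hfin : (M.visited w).Finite := Set.finite_of_encard_le_coe hf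
  have : Fintype (M.visited w) := hfin.fintype
  have hcard : Fintype.card (M.visited w) ≤ f := by
    rw [← Set.coe_fintypeCard] at hf
    exact_mod_cast hf
  let R := {c : M.Config // ∃ k, M.ReachedIn w k c}
  let φ : R → M.Q × Fin (w.length + 2) × M.visited w × (M.visited w → M.Γ) := fun c =>
    (c.1.state, ⟨c.1.inputPos, by obtain ⟨k, hk⟩ := c.2; have := hk.inputPos_le; lia⟩,
      ⟨c.1.workPos, by obtain ⟨k, hk⟩ := c.2; exact hk.workPos_mem⟩, fun z => c.1.work z)
  have hφ : Function.Injective φ := by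
    rintro ⟨c, k, hc⟩ ⟨c', k', hc'⟩ h
    simp only [φ, Prod.mk.injEq, Fin.mk.injEq, Subtype.mk.injEq] at h
    obtain ⟨h1, h2, h3, h4⟩ := h
    refine Subtype.ext (Config.ext h1 h2 h3 (funext fun z => ?_))
    by_cases hz : z ∈ M.visited w
    · exact congrFun h4 ⟨z, hz⟩
    · exact (hc.work_eq_blank hz).trans (hc'.work_eq_blank hz).symm
  have : Fintype R := Fintype.ofInjective φ hφ
  have h1 := Fintype.card_le_of_injective φ hφ
  have h2 : {c | ∃ k, M.ReachedIn w k c}.encard = (Fintype.card R : ℕ∞) :=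
    (@Set.coe_fintypeCard _ {c | ∃ k, M.ReachedIn w k c} this).symm
  rw [h2]
  refine Nat.cast_le.2 (h1.trans ?_)
  rw [Fintype.card_prod, Fintype.card_prod, Fintype.card_prod, Fintype.card_fin, Fintype.card_fun]
  have : 1 ≤ Fintype.card M.Γ := Fintype.card_pos_iff.2 ⟨M.blank⟩
  unfold configBound
  gcongr

/-- Initial segments of a shortest path are shortest paths. -/
theorem exists_first_reached {k : ℕ} {c : M.Config} (h : M.ReachedIn w k c)
    (hmin : ∀ i < k, ¬ M.ReachedIn w i c) {j : ℕ} (hj : j ≤ k) :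
    ∃ c, M.ReachedIn w j c ∧ ∀ i < j, ¬ M.ReachedIn w i c := by
  induction h with
  | init =>
    obtain rfl : j = 0 := by lia
    exact ⟨_, ReachedIn.init, fun i hi => by lia⟩
  | @step k c r hc ho hp ih =>
    rcases hj.lt_or_eq with hlt | rfl
    · exact ih (fun i hi hi' => hmin (i + 1) (by lia) (hi'.step ho hp)) (by lia)
    · exact ⟨_, hc.step ho hp, hmin⟩

/-- Along a shortest path the configurations at times `0, …, k` are first reached at those times, so
they are `k + 1` distinct reachable configurations. -/
theorem ReachedIn.exists_lt_configBound {f k : ℕ} {c : M.Config}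
    (hf : (M.visited w).encard ≤ (f : ℕ∞)) (h : M.ReachedIn w k c) :
    ∃ k < M.configBound w.length f, M.ReachedIn w k c := by
  classical
  have hex : ∃ k, M.ReachedIn w k c := ⟨k, h⟩
  refine ⟨Nat.find hex, ?_, Nat.find_spec hex⟩
  have hfirst := fun j (hj : j ≤ Nat.find hex) =>
    exists_first_reached (Nat.find_spec hex) (fun i hi => Nat.find_min hex hi) hj
  have : Nonempty M.Config := ⟨c⟩
  choose! g hg using hfirst
  have hinj : Set.InjOn g (Set.Iic (Nat.find hex)) := by
    intro i hi j hj hij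
    rcases lt_trichotomy i j with hlt | rfl | hlt
    · exact absurd (hij ▸ (hg i hi).1) ((hg j hj).2 i hlt)
    · rfl
    · exact absurd (hij ▸ (hg j hj).1) ((hg i hi).2 j hlt)
  have h1 : (Set.Iic (Nat.find hex)).encard ≤ (M.configBound w.length f : ℕ∞) := by
    rw [← hinj.encard_image]
    refine (Set.encard_le_encard ?_).trans (encard_reached_le hf)
    rintro _ ⟨j, hj, rfl⟩
    exact ⟨j, (hg j hj).1⟩
  have h2 : (Set.Iic (Nat.find hex)).encard = ((Nat.find hex + 1 : ℕ) : ℕ∞) := by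
    rw [← Finset.coe_Iic, Set.encard_coe_eq_coe_finsetCard, Nat.card_Iic]
  rw [h2] at h1
  exact_mod_cast h1

section Deterministic

theorem IsDeterministic.exists_eq_one (h : M.IsDeterministic) (q : M.Q) (σ : InputSymbol α)
    (γ : M.Γ) : ∃ r, M.δ q σ γ r = 1 := by
  by_contra! hne
  have := M.δ_sum q σ γ
  rw [Finset.sum_eq_zero fun r _ => (h q σ γ r).resolve_right (hne r)] at this
  norm_num at this

/-- The action of a deterministic machine. -/
noncomputable def detAction (M : Machine α Δ) (h : M.IsDeterministic) (q : M.Q)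
    (σ : InputSymbol α) (γ : M.Γ) : M.Q × Move × M.Γ × Move :=
  (h.exists_eq_one q σ γ).choose

theorem detAction_spec (h : M.IsDeterministic) (q : M.Q) (σ : InputSymbol α) (γ : M.Γ) :
    M.δ q σ γ (M.detAction h q σ γ) = 1 :=
  (h.exists_eq_one q σ γ).choose_spec

theorem eq_detAction (h : M.IsDeterministic) {q : M.Q} {σ : InputSymbol α} {γ : M.Γ}
    {r : M.Q × Move × M.Γ × Move} (hr : 0 < M.δ q σ γ r) : r = M.detAction h q σ γ := by
  classical
  by_contra hne
  have h1 : M.δ q σ γ r = 1 := (h q σ γ r).resolve_left hr.ne'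
  have h2 := M.δ_sum q σ γ
  have h3 := Finset.add_le_sum (f := M.δ q σ γ) (s := Finset.univ)
    (fun r _ => (M.δ_polyTime q σ γ r).1) (Finset.mem_univ r) (Finset.mem_univ _) hne
  rw [h2, h1, detAction_spec] at h3
  norm_num at h3

/-- The run of a deterministic machine, continued after halting. -/
noncomputable def detRun (M : Machine α Δ) (h : M.IsDeterministic) (w : List α) : ℕ → M.Config
  | 0 => M.init
  | k + 1 => M.next (detRun M h w k) (M.detAction h (detRun M h w k).state
      (inputAt w (detRun M h w k).inputPos) ((detRun M h w k).work (detRun M h w k).workPos))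

theorem reachedIn_iff_detRun (h : M.IsDeterministic) {k : ℕ} {c : M.Config} :
    M.ReachedIn w k c ↔
      c = M.detRun h w k ∧ ∀ i < k, M.outcome (M.detRun h w i).state = none := by
  constructor
  · intro hc
    induction hc with
    | init => exact ⟨rfl, fun i hi => by lia⟩
    | @step k c r hc ho hp ih =>
      obtain ⟨rfl, hi⟩ := ih
      refine ⟨by rw [eq_detAction h hp]; rfl, fun i hik => ?_⟩
      rcases Nat.lt_succ_iff_lt_or_eq.1 hik with h | rfl
      · exact hi i h
      · exact ho
  · rintro ⟨rfl, hi⟩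
    induction k with
    | zero => exact ReachedIn.init
    | succ k ih =>
      refine ReachedIn.step (ih fun i h => hi i (by lia)) (hi k (by lia)) ?_
      rw [prob, detAction_spec]
      exact one_pos

/-- The data of a halting run of a deterministic machine. -/
theorem exists_detRun_of_halts (h : M.IsDeterministic) {k f : ℕ} {c : M.Config}
    (hc : M.ReachedIn w k c) (ho : M.outcome c.state ≠ none)
    (hf : (M.visited w).encard ≤ (f : ℕ∞)) :
    c = M.detRun h w k ∧ (∀ i < k, M.outcome (M.detRun h w i).state = none) ∧
      k < M.configBound w.length (M.visited w).ncard ∧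
      ∃ lo : ℤ, (∀ z, (∃ i ≤ k, (M.detRun h w i).workPos = z) ↔
        lo ≤ z ∧ z < lo + (M.visited w).ncard) := by
  obtain ⟨rfl, hi⟩ := (reachedIn_iff_detRun h).1 hc
  have hfin : (M.visited w).Finite := Set.finite_of_encard_le_coe hf
  refine ⟨rfl, hi, ?_, ?_⟩
  -- A deterministic run cannot be in a halted configuration before its halting time, so the
  -- shortest time to `c` is no less than `k`.
  · obtain ⟨k', hk', hc'⟩ := hc.exists_lt_configBound (hfin.cast_ncard_eq.ge)
    obtain ⟨he, hi'⟩ := (reachedIn_iff_detRun h).1 hc'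
    rcases lt_trichotomy k k' with hlt | rfl | hlt
    · exact hlt.trans hk'
    · exact hk'
    · rw [he, hi k' hlt] at ho
      exact absurd rfl ho
  · obtain ⟨lo, v, hlo⟩ := exists_Ico_eq_path (p := fun i => (M.detRun h w i).workPos) (k := k)
      fun i _ => abs_moveWork_sub_le _ _
    have hset : M.visited w = Set.Ico lo (lo + v) := by
      ext z
      rw [Set.mem_Ico, ← hlo]
      constructor
      · rintro ⟨j, c, hj, rfl⟩
        obtain ⟨rfl, hij⟩ := (reachedIn_iff_detRun h).1 hj
        refine ⟨j, ?_, rfl⟩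
        by_contra hlt
        exact ho (hij k (by lia))
      · rintro ⟨i, hik, rfl⟩
        exact ⟨i, _, (reachedIn_iff_detRun h).2 ⟨rfl, fun j hj => hi j (by lia)⟩, rfl⟩
    have hv : (M.visited w).ncard = v := by
      rw [hset, ← Finset.coe_Ico, Set.ncard_coe_finset, Int.card_Ico]
      simp
    exact ⟨lo, by rw [hv]; exact hlo⟩

end Deterministic

end Machine

end PostTM

/-! ### The simulating machine: two stacks in blocks, and a clock. -/

namespace PostTM

/-- The control states of the simulating machine. -/
inductive SimState (QD QM ΓM : Type) where
  | build (q : QD) : SimState QD QM ΓM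
  | rewindWork : SimState QD QM ΓM
  | rewindInput : SimState QD QM ΓM
  | home (sim : Option QM) (x : ΓM) : SimState QD QM ΓM
  | push (sim : Option QM) (d : Move) (x : ΓM) (carry : Bool) : SimState QD QM ΓM
  | pop (sim : Option QM) (d : Move) (x : ΓM) : SimState QD QM ΓM
  | timeout : SimState QD QM ΓM
  deriving Fintype

/-- Replace the letters of the input by the only letter of a unary alphabet. -/
def eraseLetter {α : Type*} : InputSymbol α → InputSymbol Unit
  | .leftEnd => .leftEnd
  | .rightEnd => .rightEnd
  | .letter _ => .letter ()

theorem eraseLetter_inputAt {α : Type*} (w : List α) (i : ℕ) :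
    eraseLetter (inputAt w i) = inputAt (List.replicate w.length ()) i := by
  cases i with
  | zero => rfl
  | succ i =>
    rcases lt_or_ge i w.length with h | h
    · simp [inputAt, eraseLetter, h]
    · simp [inputAt, eraseLetter, h]

section Blocks

variable {Γ : Type} {C : ℕ}

/-- Push `x` on a block of a stack of capacity `C`; returns the symbol that drops out. -/
def pushBlock (x : Γ) (f : Fin C → Γ) : Γ × (Fin C → Γ) :=
  ((Fin.cons x f : Fin (C + 1) → Γ) (Fin.last C), Fin.init (Fin.cons x f : Fin (C + 1) → Γ))

/-- Pop a block of a stack, appending `x` at the other end; returns the symbol popped. -/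
def popBlock (x : Γ) (f : Fin C → Γ) : Γ × (Fin C → Γ) :=
  ((Fin.snoc f x : Fin (C + 1) → Γ) 0, Fin.tail (Fin.snoc f x : Fin (C + 1) → Γ))

/-- Block `j` of a stack that holds `F 1, F 2, …` receives `F (j * C)` from the previous block and
passes `F ((j + 1) * C)` on to the next: a push is a shift by one, block after block. `popBlock_eq`
reverses this. -/
theorem pushBlock_eq (F : ℕ → Γ) (j : ℕ) :
    pushBlock (F (j * C)) (fun k : Fin C => F (j * C + k + 1)) =
      (F ((j + 1) * C), fun k : Fin C => F (j * C + k)) := by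
  have h : (Fin.cons (F (j * C)) (fun k : Fin C => F (j * C + k + 1)) : Fin (C + 1) → Γ) =
      fun k : Fin (C + 1) => F (j * C + k) := by
    funext k
    refine Fin.cases ?_ (fun k => ?_) k
    · simp
    · simp [add_assoc]
  rw [pushBlock, h]
  simp only [Fin.val_last, add_mul, one_mul]
  rfl

theorem popBlock_eq (F : ℕ → Γ) (j : ℕ) :
    popBlock (F ((j + 1) * C)) (fun k : Fin C => F (j * C + k)) =
      (F (j * C), fun k : Fin C => F (j * C + k + 1)) := by
  have h : (Fin.snoc (fun k : Fin C => F (j * C + k)) (F ((j + 1) * C)) : Fin (C + 1) → Γ) =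
      fun k : Fin (C + 1) => F (j * C + k) := by
    funext k
    refine Fin.lastCases ?_ (fun k => ?_) k
    · simp [add_mul]
    · simp
  rw [popBlock, h]
  rfl

/-- The side of the head on which a stack is popped when the head moves. -/
def moveSide : Move → Option Bool
  | .left => some false
  | .right => some true
  | .stay => none

/-- Push on the stack which the head moves away from. -/
def pushSide (d : Move) (x : Γ) (f : Bool → Fin C → Γ) : Γ × (Bool → Fin C → Γ) :=
  match moveSide d with
  | none => (x, f)
  | some b => ((pushBlock x (f !b)).1, Function.update f (!b) (pushBlock x (f !b)).2)

/-- Pop the stack which the head moves to. -/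
def popSide (d : Move) (x : Γ) (f : Bool → Fin C → Γ) : Γ × (Bool → Fin C → Γ) :=
  match moveSide d with
  | none => (x, f)
  | some b => ((popBlock x (f b)).1, Function.update f b (popBlock x (f b)).2)

end Blocks

section Digits

/-- The `j`-th digit of `t` in base `b + 1`. -/
def digit (b t j : ℕ) : Fin (b + 1) := ⟨t / (b + 1) ^ j % (b + 1), Nat.mod_lt _ (Nat.succ_pos b)⟩

theorem digit_succ (b t j : ℕ) : digit b (t + 1) j =
    if decide ((b + 1) ^ j ∣ t + 1) then digit b t j + 1 else digit b t j := by
  ext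
  by_cases h : (b + 1) ^ j ∣ t + 1
  · simp only [digit, h, decide_true, if_true, Nat.succ_div, Fin.val_add]
    rcases b with _ | b
    · simp [Nat.mod_one]
    · simp [Nat.add_mod]
  · simp [digit, h, Nat.succ_div]

/-- When `t` is incremented, a carry reaches digit `j` exactly if `(b + 1) ^ j` divides `t + 1`. It
is passed on exactly if that digit is maximal. -/
theorem decide_pow_succ_dvd (b t j : ℕ) : decide ((b + 1) ^ (j + 1) ∣ t + 1) =
    (decide ((b + 1) ^ j ∣ t + 1) && decide (digit b t j = Fin.last b)) := by
  rw [← Bool.decide_and, decide_eq_decide]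
  have key : (b + 1) ^ j ∣ t + 1 → ((b + 1) ^ (j + 1) ∣ t + 1 ↔ digit b t j = Fin.last b) := by
    intro h
    have h1 : (t + 1) / (b + 1) ^ j = t / (b + 1) ^ j + 1 := by rw [Nat.succ_div, if_pos h]
    have h2 : (b + 1) ^ (j + 1) ∣ t + 1 ↔ b + 1 ∣ t / (b + 1) ^ j + 1 := by
      rw [← h1, pow_succ, Nat.dvd_div_iff_mul_dvd h]
    rw [h2, Fin.ext_iff, Fin.val_last, digit]
    dsimp only
    generalize t / (b + 1) ^ j = u
    rw [Nat.dvd_iff_mod_eq_zero]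
    have hu := Nat.mod_lt u (Nat.succ_pos b)
    rcases (Nat.lt_succ_iff.1 hu).lt_or_eq with hlt | heq
    · have : (u + 1) % (b + 1) = u % (b + 1) + 1 := by
        rw [← Nat.mod_add_mod, Nat.mod_eq_of_lt (by lia)]
      lia
    · have : (u + 1) % (b + 1) = 0 := by
        rw [← Nat.mod_add_mod]
        have : u % (b + 1) + 1 = b + 1 := by rw [heq]
        rw [this, Nat.mod_self]
      lia
  constructor
  · intro h
    have h1 : (b + 1) ^ j ∣ t + 1 := (pow_dvd_pow _ (Nat.le_succ j)).trans h
    exact ⟨h1, (key h1).1 h⟩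
  · rintro ⟨h1, h2⟩
    exact (key h1).2 h2

end Digits

section Simulator

variable {α : Type*} {Δ : Type}

/-- Work tape cells of the simulating machine: a symbol of the machine that marks the space, blocks
of the two stacks that represent the simulated tape, and a digit of the clock. -/
abbrev SimCell (D : Machine Unit Δ) (M : PTM α) (C b : ℕ) : Type :=
  D.Γ × (Bool → Fin C → M.Γ) × Fin (b + 1)

variable (D : Machine Unit Δ) (hD : D.IsDeterministic) (M : PTM α) (C b : ℕ) {m : ℕ}
  (dec : Fin (2 ^ m) → M.Q × Move × M.Γ × Move)

open Classical in
/-- The transition function of the simulating machine. -/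
noncomputable def simStep : SimState D.Q M.Q M.Γ → InputSymbol α → Option (SimCell D M C b) →
    Fin (2 ^ m) → SimState D.Q M.Q M.Γ × Move × Option (SimCell D M C b) × Move
  | .build q, σ, y, _ =>
    -- A cell not yet marked is `none` and is read as a blank of `D`, empty stack blocks and clock
    -- digit `0`.
    let c := y.getD (D.blank, fun _ _ => M.blank, 0)
    let a := D.detAction hD q (eraseLetter σ) c.1
    if D.outcome q = none then (.build a.1, a.2.1, some (a.2.2.1, c.2), a.2.2.2)
    -- This marks the cell scanned when `D` halts, which might not have been marked before.
    else (.rewindWork, .stay, some c, .stay)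
  | .rewindWork, _, some c, _ => (.rewindWork, .stay, some c, .left)
  | .rewindWork, _, none, _ => (.rewindInput, .stay, none, .stay)
  | .rewindInput, .leftEnd, y, _ => (.home (some M.start) M.blank, .stay, y, .stay)
  | .rewindInput, _, y, _ => (.rewindInput, .left, y, .stay)
  | .home none x, _, y, _ => (.push none .stay x true, .stay, y, .right)
  | .home (some q) x, σ, y, r =>
    -- If `M` has halted or the guessed action has probability zero, the simulation is abandoned but
    -- the clock goes on.
    if M.outcome q = none ∧ 0 < M.δ q σ x (dec r) then
      (.push (some (dec r).1) (dec r).2.2.2 (dec r).2.2.1 true, (dec r).2.1, y, .right)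
    else (.push none .stay x true, .stay, y, .right)
  | .push sim d x carry, _, some c, _ =>
    (.push sim d (pushSide d x c.2.1).1 (carry && decide (c.2.2 = Fin.last b)), .stay,
      some (c.1, (pushSide d x c.2.1).2, if carry then c.2.2 + 1 else c.2.2), .right)
  | .push sim d x carry, _, none, _ =>
    -- A carry out of the last digit means that the clock has overflowed.
    if carry then (.timeout, .stay, none, .stay)
    -- If the head of `M` stays, its scanned symbol is carried along and back. Otherwise the symbol
    -- that drops out of the pushed stack is discarded, and a blank enters the other stack from
    -- below.
    else (.pop sim d (if d = .stay then x else M.blank), .stay, none, .left)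
  | .pop sim d x, _, some c, _ =>
    (.pop sim d (popSide d x c.2.1).1, .stay, some (c.1, (popSide d x c.2.1).2, c.2.2), .left)
  | .pop sim _ x, _, none, _ => (.home sim x, .stay, none, .stay)
  | .timeout, _, y, _ => (.timeout, .stay, y, .stay)

/-- The outcomes of the simulating machine: `true` when the simulated machine accepts, `false` when
the clock has run out. -/
def simOutcome : SimState D.Q M.Q M.Γ → Option Bool
  | .home (some q) _ => if M.outcome q = some .accept then some true else none
  | .timeout => some false
  | _ => none

/-- The machine that marks the space used by `D`, and there simulates `M`, with a clock that counts
in base `b + 1`. -/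
noncomputable abbrev simulator : StepMachine α Bool m where
  Q := SimState D.Q M.Q M.Γ
  Γ := Option (SimCell D M C b)
  fintypeΓ := by classical infer_instance
  blank := none
  start := .build D.start
  outcome := simOutcome D M
  step := simStep D hD M C b dec

end Simulator

/-- A work tape that is blank outside the `v` cells from `lo` on. -/
def regionTape {A : Type*} (lo : ℤ) (v : ℕ) (cells : ℕ → A) : ℤ → Option A := fun z =>
  if lo ≤ z ∧ z < lo + v then some (cells (z - lo).toNat) else none

section RegionTape

variable {A : Type*} {lo : ℤ} {v : ℕ} {cells cells' : ℕ → A}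

theorem regionTape_apply {j : ℕ} (hj : j < v) : regionTape lo v cells (lo + j) = some (cells j) := by
  rw [regionTape, if_pos (by lia)]
  simp

theorem regionTape_of_lt {z : ℤ} (hz : z < lo) : regionTape lo v cells z = none :=
  if_neg (by lia)

theorem regionTape_of_ge {z : ℤ} (hz : lo + v ≤ z) : regionTape lo v cells z = none :=
  if_neg (by lia)

theorem update_regionTape {j : ℕ} (hj : j < v) (a : A) :
    Function.update (regionTape lo v cells) (lo + j) (some a) =
      regionTape lo v (Function.update cells j a) := by
  funext z
  rcases eq_or_ne z (lo + j) with rfl | hz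
  · rw [Function.update_self, regionTape_apply hj, Function.update_self]
  · rw [Function.update_of_ne hz, regionTape, regionTape]
    split_ifs with h
    · rw [Function.update_of_ne (by lia)]
    · rfl

theorem regionTape_congr (h : ∀ j < v, cells j = cells' j) :
    regionTape lo v cells = regionTape lo v cells' := by
  funext z
  rw [regionTape, regionTape]
  split_ifs with hz
  · rw [h _ (by lia)]
  · rfl

end RegionTape

end PostTM

/-! ### The two sweeps of a round. -/

namespace PostTM

namespace StepMachine

variable {α : Type*} {Δ : Type} {m : ℕ} {S : StepMachine α Δ m} {w : List α}
  {ρ : ℕ → Fin (2 ^ m)} {k : ℕ}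

theorem run_succ_eq {q q' : S.Q} {ip : ℕ} {wp : ℤ} {work : ℤ → S.Γ} {d d' : Move} {x y : S.Γ}
    (h : S.run w ρ k = ⟨q, ip, wp, work⟩) (hy : work wp = y)
    (hs : S.step q (inputAt w ip) y (ρ k) = (q', d, x, d')) :
    S.run w ρ (k + 1) = ⟨q', Machine.moveInput ip (clampMove (inputAt w ip) d),
      Machine.moveWork wp d', Function.update work wp x⟩ := by
  subst hy
  rw [run, h]
  simp only [nextCfg, action, hs]

theorem clampMove_stay (σ : InputSymbol α) : clampMove σ .stay = .stay := by cases σ <;> rfl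

/-- In the first `k` configurations the machine has not halted and its head is in `[lo, hi]`. -/
def SafeUntil (S : StepMachine α Δ m) (w : List α) (ρ : ℕ → Fin (2 ^ m)) (lo hi : ℤ) (k : ℕ) :
    Prop :=
  ∀ i < k, S.outcome (S.run w ρ i).state = none ∧
    lo ≤ (S.run w ρ i).workPos ∧ (S.run w ρ i).workPos ≤ hi

theorem SafeUntil.add {lo hi : ℤ} {n : ℕ} (h : S.SafeUntil w ρ lo hi k)
    (h' : ∀ i < n, S.outcome (S.run w ρ (k + i)).state = none ∧
      lo ≤ (S.run w ρ (k + i)).workPos ∧ (S.run w ρ (k + i)).workPos ≤ hi) :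
    S.SafeUntil w ρ lo hi (k + n) := by
  intro i hi
  rcases lt_or_ge i k with hlt | hge
  · exact h i hlt
  · have := h' (i - k) (by lia)
    rwa [show k + (i - k) = i by lia] at this

theorem SafeUntil.add_of_run {lo hi : ℤ} {n : ℕ} {q : ℕ → S.Q} {ip : ℕ → ℕ} {wp : ℕ → ℤ}
    {work : ℕ → ℤ → S.Γ} (h : S.SafeUntil w ρ lo hi k)
    (hrun : ∀ i < n, S.run w ρ (k + i) = ⟨q i, ip i, wp i, work i⟩)
    (hq : ∀ i < n, S.outcome (q i) = none) (hlo : ∀ i < n, lo ≤ wp i) (hhi : ∀ i < n, wp i ≤ hi) :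
    S.SafeUntil w ρ lo hi (k + n) := by
  refine h.add fun i hi => ?_
  rw [hrun i hi]
  exact ⟨hq i hi, hlo i hi, hhi i hi⟩

theorem SafeUntil.running {lo hi : ℤ} (h : S.SafeUntil w ρ lo hi k) : S.Running w ρ k :=
  fun i hi => (h i hi).1

end StepMachine

section Simulator

open StepMachine

variable {α : Type*} {Δ : Type} {D : Machine Unit Δ} {hD : D.IsDeterministic} {M : PTM α}
  {C b m : ℕ} {dec : Fin (2 ^ m) → M.Q × Move × M.Γ × Move} {w : List α} {ρ : ℕ → Fin (2 ^ m)}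
  {k : ℕ} {lo : ℤ} {v ip : ℕ} {cells cells' : ℕ → SimCell D M C b}

/-- Here `st j` is the control state on arrival at cell `j` of the region, and the sweep has
rewritten precisely the cells before `j`. -/
theorem simulator_sweep_right {st : ℕ → SimState D.Q M.Q M.Γ}
    (hstep : ∀ j < v, ∀ r, simStep D hD M C b dec (st j) (inputAt w ip) (some (cells j)) r =
      (st (j + 1), .stay, some (cells' j), .right))
    (h : (simulator D hD M C b dec).run w ρ k = ⟨st 0, ip, lo, regionTape lo v cells⟩) {j : ℕ}
    (hj : j ≤ v) : (simulator D hD M C b dec).run w ρ (k + j) =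
      ⟨st j, ip, lo + j, regionTape lo v fun i => if i < j then cells' i else cells i⟩ := by
  induction j with
  | zero => simpa using h
  | succ j ih =>
    have hcell : regionTape lo v (fun i => if i < j then cells' i else cells i) (lo + j) =
        some (cells j) := by
      rw [regionTape_apply (by lia), if_neg (lt_irrefl j)]
    rw [← add_assoc, run_succ_eq (ih (by lia)) hcell (hstep j (by lia) _),
      clampMove_stay, update_regionTape (by lia)]
    congr 1
    · simp only [Machine.moveWork]
      push_cast
      ring
    · refine regionTape_congr fun i _ => ?_
      rcases eq_or_ne i j with rfl | hij
      · simp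
      · rw [Function.update_of_ne hij]
        exact if_congr (by lia) rfl rfl

theorem simulator_sweep_left {st : ℕ → SimState D.Q M.Q M.Γ}
    (hstep : ∀ j < v, ∀ r, simStep D hD M C b dec (st (j + 1)) (inputAt w ip) (some (cells j)) r =
      (st j, .stay, some (cells' j), .left))
    (h : (simulator D hD M C b dec).run w ρ k =
      ⟨st v, ip, lo + v - 1, regionTape lo v cells⟩) {j : ℕ}
    (hj : j ≤ v) : (simulator D hD M C b dec).run w ρ (k + j) =
      ⟨st (v - j), ip, lo + v - 1 - j,
        regionTape lo v fun i => if v - j ≤ i then cells' i else cells i⟩ := by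
  induction j with
  | zero =>
    simp only [add_zero, Nat.sub_zero, Nat.cast_zero, sub_zero]
    rw [h]
    congr 1
    exact regionTape_congr fun i hi => by rw [if_neg (by lia)]
  | succ j ih =>
    have e : lo + v - 1 - j = lo + (v - (j + 1) : ℕ) := by push_cast [hj]; ring
    have hcell : regionTape lo v (fun i => if v - j ≤ i then cells' i else cells i)
        (lo + v - 1 - j) = some (cells (v - (j + 1))) := by
      rw [e, regionTape_apply (by lia), if_neg (by lia)]
    have hs := hstep (v - (j + 1)) (by lia) (ρ (k + j))
    rw [show v - (j + 1) + 1 = v - j by lia] at hs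
    rw [← add_assoc, run_succ_eq (ih (by lia)) hcell hs,
      clampMove_stay, e, update_regionTape (by lia)]
    congr 1
    · simp only [Machine.moveWork]
      push_cast [hj]
      ring
    · refine regionTape_congr fun i _ => ?_
      rcases eq_or_ne i (v - (j + 1)) with rfl | hij
      · simp
      · rw [Function.update_of_ne hij]
        exact if_congr (by lia) rfl rfl

/-- The cells at the beginning of the round with number `t`. -/
def roundCells (D : Machine Unit Δ) (M : PTM α) (C b : ℕ) (g : ℕ → D.Γ)
    (blk : ℕ → Bool → Fin C → M.Γ) (t : ℕ) : ℕ → SimCell D M C b :=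
  fun j => (g j, blk j, digit b t j)

variable {g : ℕ → D.Γ} {blk blk₁ blk₂ : ℕ → Bool → Fin C → M.Γ} {t : ℕ} {sim sim' : Option M.Q}
  {x₀ x : M.Γ} {d dᵢ : Move} {xs ys : ℕ → M.Γ}

/-- The first half of a round. -/
theorem simulator_push
    (h : (simulator D hD M C b dec).run w ρ k =
      ⟨.home sim x₀, ip, lo - 1, regionTape lo v (roundCells D M C b g blk t)⟩)
    (hacc : simOutcome D M (.home sim x₀) = none)
    (hstep : simStep D hD M C b dec (.home sim x₀) (inputAt w ip) none (ρ k) =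
      (.push sim' d (xs 0) true, dᵢ, none, .right))
    (hpush : ∀ j < v, pushSide d (xs j) (blk j) = (xs (j + 1), blk₁ j))
    (hsafe : (simulator D hD M C b dec).SafeUntil w ρ (lo - 1) (lo + v) k) :
    (simulator D hD M C b dec).run w ρ (k + 1 + v) =
      ⟨.push sim' d (xs v) (decide ((b + 1) ^ v ∣ t + 1)),
        Machine.moveInput ip (clampMove (inputAt w ip) dᵢ), lo + v,
        regionTape lo v (roundCells D M C b g blk₁ (t + 1))⟩ ∧
      (simulator D hD M C b dec).SafeUntil w ρ (lo - 1) (lo + v) (k + 1 + v + 1) := by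
  have hblank : regionTape lo v (roundCells D M C b g blk t) (lo - 1) = none :=
    regionTape_of_lt (by lia)
  have h1 := run_succ_eq h hblank hstep
  rw [← hblank, Function.update_eq_self] at h1
  set ip' := Machine.moveInput ip (clampMove (inputAt w ip) dᵢ)
  have h2 := fun j hj => simulator_sweep_right (hD := hD) (dec := dec) (w := w) (ρ := ρ)
    (k := k + 1) (lo := lo) (v := v) (ip := ip') (cells := roundCells D M C b g blk t)
    (cells' := roundCells D M C b g blk₁ (t + 1)) (j := j)
    -- The divisibility condition is the carry into digit `j`; for `j = 0` it holds, which is the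
    -- increment itself.
    (st := fun j => .push sim' d (xs j) (decide ((b + 1) ^ j ∣ t + 1)))
    (by
      intro j hj r
      simp only [simStep, roundCells, hpush j hj, decide_pow_succ_dvd, digit_succ]
      congr)
    (by
      rw [h1]
      simp [Machine.moveWork]) hj
  refine ⟨?_, ?_⟩
  · rw [h2 v le_rfl]
    congr 1
    exact regionTape_congr fun j hj => if_pos hj
  · have hs1 : (simulator D hD M C b dec).SafeUntil w ρ (lo - 1) (lo + v) (k + 1) :=
      hsafe.add_of_run (n := 1) (q := fun _ => .home sim x₀) (ip := fun _ => ip)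
        (wp := fun _ => lo - 1) (work := fun _ => _)
        (fun i hi => by obtain rfl : i = 0 := by lia
                        exact h) (fun _ _ => hacc) (fun _ _ => le_rfl) (fun _ _ => by lia)
    exact hs1.add_of_run (n := v + 1) (fun i hi => h2 i (by lia)) (fun _ _ => rfl)
      (fun _ _ => by lia) (fun _ _ => by lia)

theorem simulator_timeout
    (h : (simulator D hD M C b dec).run w ρ k =
      ⟨.push sim' d x true, ip, lo + v, regionTape lo v cells⟩) :
    (simulator D hD M C b dec).run w ρ (k + 1) =
      ⟨.timeout, ip, lo + v, regionTape lo v cells⟩ := by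
  have hblank : regionTape lo v cells (lo + v) = none := regionTape_of_ge (by lia)
  rw [run_succ_eq (q' := SimState.timeout) (d := .stay) (d' := .stay) (x := none) h hblank
    (by simp [simStep]), clampMove_stay, ← hblank, Function.update_eq_self]
  rfl

/-- The second half of a round. -/
theorem simulator_pop
    (h : (simulator D hD M C b dec).run w ρ k =
      ⟨.push sim' d x false, ip, lo + v, regionTape lo v (roundCells D M C b g blk₁ t)⟩)
    (hv : ys v = if d = .stay then x else M.blank)
    (hpop : ∀ j < v, popSide d (ys (j + 1)) (blk₁ j) = (ys j, blk₂ j))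
    (hsafe : (simulator D hD M C b dec).SafeUntil w ρ (lo - 1) (lo + v) (k + 1)) :
    (simulator D hD M C b dec).run w ρ (k + 1 + v + 1) =
      ⟨.home sim' (ys 0), ip, lo - 1, regionTape lo v (roundCells D M C b g blk₂ t)⟩ ∧
      (simulator D hD M C b dec).SafeUntil w ρ (lo - 1) (lo + v) (k + 1 + v + 1) := by
  have hblank : regionTape lo v (roundCells D M C b g blk₁ t) (lo + v) = none :=
    regionTape_of_ge (by lia)
  have h1 := run_succ_eq (q' := SimState.pop sim' d (ys v)) (d := .stay) (d' := .left) (x := none) h hblank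
    (by simp [simStep, hv])
  rw [clampMove_stay, ← hblank, Function.update_eq_self] at h1
  have h2 := fun j hj => simulator_sweep_left (hD := hD) (dec := dec) (w := w) (ρ := ρ)
    (k := k + 1) (lo := lo) (v := v) (ip := ip) (cells := roundCells D M C b g blk₁ t)
    (cells' := roundCells D M C b g blk₂ t) (j := j)
    (st := fun j => .pop sim' d (ys j))
    (by
      intro j hj r
      simp only [simStep, roundCells, hpop j hj])
    (by
      rw [h1]
      simp [Machine.moveWork, Machine.moveInput]) hj
  have h3 : (simulator D hD M C b dec).run w ρ (k + 1 + v) =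
      ⟨.pop sim' d (ys 0), ip, lo - 1, regionTape lo v (roundCells D M C b g blk₂ t)⟩ := by
    rw [h2 v le_rfl, Nat.sub_self]
    congr 1
    · ring
  have hblank' : regionTape lo v (roundCells D M C b g blk₂ t) (lo - 1) = none :=
    regionTape_of_lt (by lia)
  refine ⟨?_, ?_⟩
  · rw [run_succ_eq (q' := SimState.home sim' (ys 0)) (d := .stay) (d' := .stay) (x := none) h3 hblank'
      (by simp [simStep]), clampMove_stay, ← hblank', Function.update_eq_self]
    rfl
  · exact hsafe.add_of_run (n := v + 1) (fun i hi => h2 i (by lia)) (fun _ _ => rfl)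
      (fun _ _ => by lia) (fun _ _ => by lia)

end Simulator

end PostTM

/-! ### Marking the space and rewinding the heads. -/

namespace PostTM

section Simulator

open StepMachine

variable {α : Type*} {Δ : Type} {D : Machine Unit Δ} {hD : D.IsDeterministic} {M : PTM α}
  {C b m : ℕ} {dec : Fin (2 ^ m) → M.Q × Move × M.Γ × Move} {w : List α} {ρ : ℕ → Fin (2 ^ m)}

theorem clampMove_eq_self {Δ' : Type} (N : Machine α Δ') {q q' : N.Q} {σ : InputSymbol α} {γ γ' : N.Γ}
    {d d' : Move} (h : 0 < N.δ q σ γ (q', d, γ', d')) : clampMove σ d = d := by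
  cases σ <;> cases d <;> try rfl
  · rw [N.δ_leftEnd] at h
    exact absurd h (lt_irrefl _)
  · rw [N.δ_rightEnd] at h
    exact absurd h (lt_irrefl _)

theorem clampMove_eraseLetter (σ : InputSymbol α) (d : Move) :
    clampMove (eraseLetter σ) d = clampMove σ d := by
  cases σ <;> cases d <;> rfl

namespace Machine

theorem detRun_work_eq_blank {α : Type*} {M : Machine α Δ} (h : M.IsDeterministic) {w : List α}
    {k : ℕ} {z : ℤ} (hz : ∀ i < k, (M.detRun h w i).workPos ≠ z) :
    (M.detRun h w k).work z = M.blank := by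
  induction k with
  | zero => rfl
  | succ k ih =>
    exact (Function.update_of_ne (hz k (by lia)).symm _ _).trans (ih fun i hi => hz i (by lia))

end Machine

open Classical in
/-- The work tape of the simulating machine after `k` steps of `D`: the cells that have been
scanned are marked. -/
noncomputable def buildTape (hD : D.IsDeterministic) (M : PTM α) (C b : ℕ) (w : List Unit)
    (k : ℕ) : ℤ → Option (SimCell D M C b) := fun z =>
  if ∃ i < k, (D.detRun hD w i).workPos = z then
    some ((D.detRun hD w k).work z, fun _ _ => M.blank, 0) else none

theorem getD_buildTape (w : List Unit) (k : ℕ) (z : ℤ) :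
    (buildTape hD M C b w k z).getD (D.blank, fun _ _ => M.blank, 0) =
      ((D.detRun hD w k).work z, fun _ _ => M.blank, 0) := by
  unfold buildTape
  split_ifs with h
  · rfl
  · push Not at h
    rw [Machine.detRun_work_eq_blank hD h]
    rfl

/-- The tape `u` is arbitrary at the scanned cell so that this covers both a step of `D`, which
writes there, and the final marking of the halting cell, which does not. -/
theorem update_buildTape (w : List Unit) (k : ℕ) (u : ℤ → D.Γ)
    (hu : ∀ z ≠ (D.detRun hD w k).workPos, u z = (D.detRun hD w k).work z) :
    Function.update (buildTape hD M C b w k) (D.detRun hD w k).workPos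
      (some (u (D.detRun hD w k).workPos, fun _ _ => M.blank, 0)) =
    open Classical in fun z => if ∃ i < k + 1, (D.detRun hD w i).workPos = z then
      some (u z, fun _ _ => M.blank, 0) else none := by
  classical
  funext z
  rcases eq_or_ne z (D.detRun hD w k).workPos with rfl | hz
  · rw [Function.update_self, if_pos ⟨k, by lia, rfl⟩]
  · rw [Function.update_of_ne hz, buildTape, hu z hz]
    refine if_congr ⟨?_, ?_⟩ rfl rfl
    · rintro ⟨i, hi, h⟩
      exact ⟨i, by lia, h⟩
    · rintro ⟨i, hi, h⟩
      refine ⟨i, ?_, h⟩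
      by_contra hlt
      obtain rfl : i = k := by lia
      exact hz h.symm

theorem simulator_build {k₀ : ℕ}
    (hrun : ∀ i < k₀, D.outcome (D.detRun hD (List.replicate w.length ()) i).state = none) {k : ℕ}
    (hk : k ≤ k₀) : (simulator D hD M C b dec).run w ρ k =
      ⟨.build (D.detRun hD (List.replicate w.length ()) k).state,
        (D.detRun hD (List.replicate w.length ()) k).inputPos,
        (D.detRun hD (List.replicate w.length ()) k).workPos,
        buildTape hD M C b (List.replicate w.length ()) k⟩ := by
  induction k with
  | zero =>
    simp only [run, Machine.detRun, Machine.init]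
    congr 1
  | succ k ih =>
    set c := D.detRun hD (List.replicate w.length ()) k with hc
    set a := D.detAction hD c.state (inputAt (List.replicate w.length ()) c.inputPos)
      (c.work c.workPos) with ha
    have hnext : D.detRun hD (List.replicate w.length ()) (k + 1) = D.next c a := rfl
    have hs : simStep D hD M C b dec (.build c.state) (inputAt w c.inputPos)
        (buildTape hD M C b (List.replicate w.length ()) k c.workPos) (ρ k) =
        (.build a.1, a.2.1, some (a.2.2.1, fun _ _ => M.blank, 0), a.2.2.2) := by
      simp only [simStep]
      rw [getD_buildTape, if_pos (hrun k (by lia)), eraseLetter_inputAt]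
    have hclamp : clampMove (inputAt w c.inputPos) a.2.1 = a.2.1 := by
      rw [← clampMove_eraseLetter, eraseLetter_inputAt]
      refine clampMove_eq_self D (q := c.state) (γ := c.work c.workPos) (q' := a.1) (γ' := a.2.2.1)
        (d' := a.2.2.2) ?_
      exact (Machine.detAction_spec hD _ _ _).symm ▸ one_pos
    rw [run_succ_eq (ih (by lia)) rfl hs, hclamp, hnext]
    congr 1
    have := update_buildTape (hD := hD) (M := M) (C := C) (b := b) (List.replicate w.length ()) k
      (Function.update c.work c.workPos a.2.2.1) (fun z hz => Function.update_of_ne hz _ _)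
    rw [← hc, Function.update_self] at this
    rw [this]
    rfl

/-- The tape of the simulating machine at the start of the first round. -/
theorem simulator_init {k₀ n : ℕ} {lo : ℤ} {v : ℕ}
    (hn : n = w.length)
    (hrun : ∀ i < k₀, D.outcome (D.detRun hD (List.replicate n ()) i).state = none)
    (hhalt : D.outcome (D.detRun hD (List.replicate n ()) k₀).state ≠ none)
    (hlo : ∀ z, (∃ i ≤ k₀, (D.detRun hD (List.replicate n ()) i).workPos = z) ↔
      lo ≤ z ∧ z < lo + v) {k₁ : ℕ}
    (hk₁ : k₁ = k₀ + 1 + ((D.detRun hD (List.replicate n ()) k₀).workPos - lo + 1).toNat + 1 +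
      (D.detRun hD (List.replicate n ()) k₀).inputPos + 1) :
    (simulator D hD M C b dec).run w ρ k₁ =
      ⟨.home (some M.start) M.blank, 0, lo - 1, regionTape lo v (roundCells D M C b
        (fun j => (D.detRun hD (List.replicate n ()) k₀).work (lo + j))
        (fun _ _ _ => M.blank) 0)⟩ ∧
    (simulator D hD M C b dec).SafeUntil w ρ (lo - 1) (lo + v) k₁ := by
  subst hn
  set c := D.detRun hD (List.replicate w.length ()) k₀ with hc
  set T := regionTape lo v (roundCells D M C b (fun j => c.work (lo + j))
        (fun _ _ _ => M.blank) 0) with hT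
  have hpos : ∀ i ≤ k₀, lo ≤ (D.detRun hD (List.replicate w.length ()) i).workPos ∧
      (D.detRun hD (List.replicate w.length ()) i).workPos < lo + v :=
    fun i hi => (hlo _).1 ⟨i, hi, rfl⟩
  have hcpos := hpos k₀ le_rfl
  rw [← hc] at hcpos
  have hsafe₀ : (simulator D hD M C b dec).SafeUntil w ρ (lo - 1) (lo + v) (k₀ + 1) := by
    intro i hi
    rw [simulator_build hrun (by lia)]
    have := hpos i (by lia)
    exact ⟨rfl, by dsimp only; lia, by dsimp only; lia⟩
  have h1 : (simulator D hD M C b dec).run w ρ (k₀ + 1) =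
      ⟨.rewindWork, c.inputPos, c.workPos, T⟩ := by
    have hs : simStep D hD M C b dec (.build c.state) (inputAt w c.inputPos)
        (buildTape hD M C b (List.replicate w.length ()) k₀ c.workPos) (ρ k₀) =
        (.rewindWork, .stay, some (c.work c.workPos, fun _ _ => M.blank, 0), .stay) := by
      simp only [simStep]
      rw [getD_buildTape, if_neg hhalt]
    rw [run_succ_eq (simulator_build hrun le_rfl) rfl hs, clampMove_stay, ← hc]
    congr 1
    have := update_buildTape (hD := hD) (M := M) (C := C) (b := b) (List.replicate w.length ()) k₀
      c.work (fun z hz => rfl)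
    rw [← hc] at this
    rw [this, hT]
    funext z
    rw [regionTape]
    refine ite_congr ?_ (fun hz => ?_) fun _ => rfl
    · rw [← hlo]
      simp only [Nat.lt_succ_iff]
    · have hd : digit b 0 (z - lo).toNat = 0 := by
        ext
        simp [digit]
      rw [roundCells, hd, Int.toNat_of_nonneg (by lia), add_sub_cancel]
  have h2 : ∀ j : ℕ, (j : ℤ) ≤ c.workPos - lo + 1 →
      (simulator D hD M C b dec).run w ρ (k₀ + 1 + j) =
        ⟨.rewindWork, c.inputPos, c.workPos - j, T⟩ := by
    intro j
    induction j with
    | zero => intro _; simpa using h1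
    | succ j ih =>
      intro hj
      push_cast at hj
      have e : c.workPos - j = lo + ((c.workPos - j - lo).toNat : ℕ) := by lia
      have hT' : ∃ y, T (c.workPos - j) = some y := by
        rw [e]
        exact ⟨_, regionTape_apply (by lia)⟩
      obtain ⟨y, hy⟩ := hT'
      have := run_succ_eq (q' := SimState.rewindWork) (d := .stay) (x := some y) (d' := .left)
        (ih (by lia)) hy rfl
      rw [clampMove_stay, ← hy, Function.update_eq_self] at this
      rw [← add_assoc, this]
      congr 1
      simp only [Machine.moveWork]
      push_cast
      ring
  set n₁ := (c.workPos - lo + 1).toNat with hn₁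
  have hn₁' : (n₁ : ℤ) = c.workPos - lo + 1 := by lia
  have hblank : T (lo - 1) = none := regionTape_of_lt (by lia)
  have h3 : (simulator D hD M C b dec).run w ρ (k₀ + 1 + n₁ + 1) =
      ⟨.rewindInput, c.inputPos, lo - 1, T⟩ := by
    have h := h2 n₁ (by lia)
    rw [show c.workPos - n₁ = lo - 1 by lia] at h
    have := run_succ_eq (q' := SimState.rewindInput) (d := .stay) (x := none) (d' := .stay)
      h hblank rfl
    rw [clampMove_stay, ← hblank, Function.update_eq_self] at this
    exact this
  have hletter : ∀ i, inputAt w (i + 1) ≠ .leftEnd := by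
    intro i
    simp only [inputAt]
    split <;> simp
  have h4 : ∀ j ≤ c.inputPos, (simulator D hD M C b dec).run w ρ (k₀ + 1 + n₁ + 1 + j) =
        ⟨.rewindInput, c.inputPos - j, lo - 1, T⟩ := by
    intro j
    induction j with
    | zero => intro _; simpa using h3
    | succ j ih =>
      intro hj
      have hne := hletter (c.inputPos - (j + 1))
      rw [show c.inputPos - (j + 1) + 1 = c.inputPos - j by lia] at hne
      have hs : simStep D hD M C b dec .rewindInput (inputAt w (c.inputPos - j)) none
          (ρ (k₀ + 1 + n₁ + 1 + j)) = (.rewindInput, .left, none, .stay) := by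
        revert hne
        cases inputAt w (c.inputPos - j) <;> simp [simStep]
      have hcl : clampMove (inputAt w (c.inputPos - j)) .left = .left := by
        revert hne
        cases inputAt w (c.inputPos - j) <;> simp [clampMove]
      have := run_succ_eq (ih (by lia)) hblank hs
      rw [hcl, ← hblank, Function.update_eq_self] at this
      rw [← add_assoc, this]
      rfl
  have h5 : (simulator D hD M C b dec).run w ρ k₁ =
      ⟨.home (some M.start) M.blank, 0, lo - 1, T⟩ := by
    have h := h4 c.inputPos le_rfl
    rw [Nat.sub_self] at h
    have := run_succ_eq (q' := SimState.home (some M.start) M.blank) (d := .stay) (x := none)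
      (d' := .stay) h hblank rfl
    rw [clampMove_stay, ← hblank, Function.update_eq_self] at this
    rw [hk₁]
    exact this
  refine ⟨h5, ?_⟩
  have hs1 := hsafe₀.add_of_run (n := n₁) (wp := fun j => c.workPos - j) (fun i hi => h2 i (by lia)) (fun _ _ => rfl)
    (fun i hi => by lia) (fun i hi => by lia)
  have hs2 := hs1.add_of_run (n := 1) (q := fun _ => SimState.rewindWork)
    (ip := fun _ => c.inputPos) (wp := fun _ => c.workPos - n₁) (work := fun _ => T) (fun i hi => by
      obtain rfl : i = 0 := by lia
      exact h2 n₁ (by lia)) (fun _ _ => rfl)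
    (fun i hi => by lia) (fun i hi => by lia)
  have hs3 := hs2.add_of_run (n := c.inputPos + 1) (fun i hi => h4 i (by lia)) (fun _ _ => rfl)
    (fun i hi => by lia) (fun i hi => by lia)
  rw [hk₁]
  exact hs3

end Simulator

end PostTM

/-! ### Correctness of one simulated step. -/

namespace PostTM

section Simulator

open StepMachine

variable {α : Type*} {Δ : Type} {D : Machine Unit Δ} {hD : D.IsDeterministic} {M : PTM α}
  {C b m : ℕ} {dec : Fin (2 ^ m) → M.Q × Move × M.Γ × Move} {w : List α} {ρ : ℕ → Fin (2 ^ m)}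

/-- The direction of a side of the work tape. -/
def sideSign : Bool → ℤ
  | true => 1
  | false => -1

theorem sideSign_not (s : Bool) : sideSign (!s) = -sideSign s := by cases s <;> rfl

/-- The two stacks that represent the work tape of a configuration, cut into blocks of length `C`:
the cells to the right of the head and those to its left. -/
def encBlocks (C : ℕ) (c : M.Config) : ℕ → Bool → Fin C → M.Γ := fun j s k =>
  c.work (c.workPos + sideSign s * (1 + (j * C + k : ℕ)))

theorem moveWork_eq_of_moveSide {d : Move} {s : Bool} (h : moveSide d = some s) (z : ℤ) :
    Machine.moveWork z d = z + sideSign s := by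
  cases d <;> simp only [moveSide, Option.some.injEq, reduceCtorEq] at h <;> subst h <;> rfl

/-- Relative to the new head position, the cells behind the head are the old ones with the written
symbol pushed in front, and those ahead lose their first symbol, which becomes the scanned one. The
only boundary condition is that the symbol entering from beyond block `v` is blank. -/
theorem exists_push_pop (c : M.Config) (a : M.Q × Move × M.Γ × Move) (v : ℕ)
    (hblank : ∀ s, moveSide a.2.2.2 = some s →
      (M.next c a).work (c.workPos + sideSign s * (1 + (v * C : ℕ))) = M.blank) :
    ∃ (xs ys : ℕ → M.Γ) (blk : ℕ → Bool → Fin C → M.Γ), xs 0 = a.2.2.1 ∧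
      (∀ j, pushSide a.2.2.2 (xs j) (encBlocks C c j) = (xs (j + 1), blk j)) ∧
      (∀ j, popSide a.2.2.2 (ys (j + 1)) (blk j) = (ys j, encBlocks C (M.next c a) j)) ∧
      ys 0 = (M.next c a).work (M.next c a).workPos ∧
      ys v = if a.2.2.2 = .stay then xs v else M.blank := by
  obtain ⟨q', dᵢ, γ', d⟩ := a
  have hself : (M.next c (q', dᵢ, γ', d)).work c.workPos = γ' := Function.update_self ..
  have hne : ∀ z ≠ c.workPos, (M.next c (q', dᵢ, γ', d)).work z = c.work z :=
    fun z hz => Function.update_of_ne hz _ _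
  have hsign : ∀ s, sideSign s = 1 ∨ sideSign s = -1 := fun s => by cases s <;> simp [sideSign]
  rcases hs : moveSide d with _ | s
  · have hd : d = .stay := by cases d <;> simp_all [moveSide]
    subst hd
    refine ⟨fun _ => γ', fun _ => γ', encBlocks C c, rfl, fun j => by simp [pushSide, moveSide],
      fun j => ?_, hself.symm, by simp⟩
    simp only [popSide, moveSide, Prod.mk.injEq, true_and]
    funext s k
    refine (hne _ ?_).symm
    have := hsign s
    change c.workPos + _ ≠ _
    rcases this with h | h <;> rw [h] <;> lia
  · have hd : d ≠ .stay := by rintro rfl; simp [moveSide] at hs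
    have hmove : (M.next c (q', dᵢ, γ', d)).workPos = c.workPos + sideSign s :=
      moveWork_eq_of_moveSide hs _
    set c' := M.next c (q', dᵢ, γ', d) with hc'
    -- `F` reads the new tape from the old head position backwards, `E` reads it from the new head
    -- position onwards.
    let F : ℕ → M.Γ := fun i => c'.work (c.workPos - sideSign s * i)
    let E : ℕ → M.Γ := fun i => c'.work (c.workPos + sideSign s * (1 + i))
    have hF : ∀ j, encBlocks C c j (!s) = fun k : Fin C => F (j * C + k + 1) := by
      intro j
      funext k
      refine Eq.trans (hne _ ?_).symm (congrArg c'.work ?_)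
      · rw [sideSign_not]
        rcases hsign s with h | h <;> rw [h] <;> lia
      · rw [sideSign_not]
        push_cast
        ring
    have hE : ∀ j, encBlocks C c j s = fun k : Fin C => E (j * C + k) := by
      intro j
      funext k
      refine Eq.trans (hne _ ?_).symm (congrArg c'.work ?_)
      · rcases hsign s with h | h <;> rw [h] <;> lia
      · push_cast
        ring
    have hns : s ≠ !s := by cases s <;> simp
    refine ⟨fun j => F (j * C), fun j => E (j * C), fun j => Function.update (encBlocks C c j) (!s)
      fun k : Fin C => F (j * C + k), ?_, fun j => ?_, fun j => ?_, ?_, ?_⟩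
    · simpa [F] using hself
    · simp only [pushSide, hs]
      rw [hF, pushBlock_eq]
    · simp only [popSide, hs]
      rw [Function.update_of_ne hns, hE, popBlock_eq]
      refine Prod.ext rfl (funext fun s' => ?_)
      dsimp only
      rcases eq_or_ne s' s with rfl | hs'
      · rw [Function.update_self]
        funext k
        refine congrArg c'.work ?_
        rw [hmove]
        push_cast
        ring
      · obtain rfl : s' = !s := by cases s <;> cases s' <;> simp_all
        rw [Function.update_of_ne hns.symm, Function.update_self]
        funext k
        refine congrArg c'.work ?_
        rw [hmove, sideSign_not]
        push_cast
        ring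
    · simp only [E]
      rw [hmove]
      simp
    · rw [if_neg hd]
      exact hblank s hs

/-- What the home state and the blocks of the simulating machine say about the simulated machine;
`none` stands for an abandoned simulation. -/
def Represents (C : ℕ) : Option M.Config → Option M.Q → M.Γ → ℕ → (ℕ → Bool → Fin C → M.Γ) → Prop
  | none, sim, _, _, _ => sim = none
  | some c, sim, x, ip, blk =>
    sim = some c.state ∧ x = c.work c.workPos ∧ ip = c.inputPos ∧ blk = encBlocks C c

open Classical in
/-- One simulated step, with random bits `r`. -/
noncomputable def simNext (dec : Fin (2 ^ m) → M.Q × Move × M.Γ × Move) (w : List α)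
    (oc : Option M.Config) (r : Fin (2 ^ m)) : Option M.Config :=
  oc.bind fun c => if M.outcome c.state = none ∧ 0 < M.prob w c (dec r) then
    some (M.next c (dec r)) else none

/-- The simulated run, with the random bits used in each round. -/
noncomputable def simTrace (dec : Fin (2 ^ m) → M.Q × Move × M.Γ × Move) (w : List α)
    (r : ℕ → Fin (2 ^ m)) : ℕ → Option M.Config
  | 0 => some M.init
  | i + 1 => simNext dec w (simTrace dec w r i) (r i)

theorem reachedIn_of_simTrace {r : ℕ → Fin (2 ^ m)} {i : ℕ} {c : M.Config}
    (h : simTrace dec w r i = some c) : M.ReachedIn w i c := by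
  induction i generalizing c with
  | zero =>
    obtain rfl : M.init = c := by simpa [simTrace] using h
    exact .init
  | succ i ih =>
    rw [simTrace, simNext, Option.bind_eq_some_iff] at h
    obtain ⟨c', hc', h⟩ := h
    split_ifs at h with hc
    obtain rfl := Option.some.inj h
    exact (ih hc').step hc.1 hc.2

theorem simTrace_congr {r r' : ℕ → Fin (2 ^ m)} {i : ℕ} (h : ∀ j < i, r j = r' j) :
    simTrace dec w r i = simTrace dec w r' i := by
  induction i with
  | zero => rfl
  | succ i ih => rw [simTrace, simTrace, ih fun j hj => h j (by lia), h i (by lia)]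

/-- Every action is coded by some bits, so each branch of `M` can be guessed. -/
theorem exists_simTrace (hdec : Function.Surjective dec) {k : ℕ} {c : M.Config}
    (h : M.ReachedIn w k c) : ∃ r, simTrace dec w r k = some c ∧
      ∀ i < k, ∀ c, simTrace dec w r i = some c → M.outcome c.state = none := by
  induction h with
  | init => exact ⟨fun _ => 0, rfl, fun i hi => by lia⟩
  | @step k c a hc ho hp ih =>
    obtain ⟨r, hr, hi⟩ := ih
    obtain ⟨x, rfl⟩ := hdec a
    have hcongr : ∀ j < k, r j = Function.update r k x j :=
      fun j hj => by rw [Function.update_of_ne (by lia)]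
    refine ⟨Function.update r k x, ?_, fun i hik c' hc' => ?_⟩
    · rw [simTrace, ← simTrace_congr hcongr, hr, Function.update_self, simNext, Option.bind_some,
        if_pos ⟨ho, hp⟩]
    · rw [← simTrace_congr fun j hj => hcongr j (by lia)] at hc'
      rcases Nat.lt_succ_iff_lt_or_eq.1 hik with h | rfl
      · exact hi i h c' hc'
      · rw [hr] at hc'
        obtain rfl := Option.some.inj hc'
        exact ho

theorem exists_round {oc : Option M.Config} {i v f : ℕ} {sim : Option M.Q} {x : M.Γ} {ip : ℕ}
    {blk : ℕ → Bool → Fin C → M.Γ} {r : Fin (2 ^ m)}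
    (hf : (M.visited w).encard ≤ (f : ℕ∞)) (hfv : f ≤ v * C)
    (hoc : ∀ c, oc = some c → M.ReachedIn w i c) (h : Represents C oc sim x ip blk) :
    ∃ (sim' : Option M.Q) (d dᵢ : Move) (xs ys : ℕ → M.Γ) (blk₁ blk₂ : ℕ → Bool → Fin C → M.Γ),
      simStep D hD M C b dec (.home sim x) (inputAt w ip) none r =
        (.push sim' d (xs 0) true, dᵢ, none, .right) ∧
      (∀ j < v, pushSide d (xs j) (blk j) = (xs (j + 1), blk₁ j)) ∧
      (∀ j < v, popSide d (ys (j + 1)) (blk₁ j) = (ys j, blk₂ j)) ∧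
      (ys v = if d = .stay then xs v else M.blank) ∧
      Represents C (simNext dec w oc r) sim' (ys 0)
        (Machine.moveInput ip (clampMove (inputAt w ip) dᵢ)) blk₂ := by
  -- An abandoned simulation performs an idle round: nothing is pushed or popped, and a fixed symbol
  -- travels to the far end and back.
  have hdead : simStep D hD M C b dec (.home sim x) (inputAt w ip) none r =
      (.push none .stay x true, .stay, none, .right) → simNext dec w oc r = none →
      ∃ (sim' : Option M.Q) (d dᵢ : Move) (xs ys : ℕ → M.Γ) (blk₁ blk₂ : ℕ → Bool → Fin C → M.Γ),
      simStep D hD M C b dec (.home sim x) (inputAt w ip) none r =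
        (.push sim' d (xs 0) true, dᵢ, none, .right) ∧
      (∀ j < v, pushSide d (xs j) (blk j) = (xs (j + 1), blk₁ j)) ∧
      (∀ j < v, popSide d (ys (j + 1)) (blk₁ j) = (ys j, blk₂ j)) ∧
      (ys v = if d = .stay then xs v else M.blank) ∧
      Represents C (simNext dec w oc r) sim' (ys 0)
        (Machine.moveInput ip (clampMove (inputAt w ip) dᵢ)) blk₂ := by
    intro h1 h2
    refine ⟨none, .stay, .stay, fun _ => x, fun _ => x, blk, blk, h1, ?_, ?_, ?_, ?_⟩
    · simp [pushSide, moveSide]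
    · simp [popSide, moveSide]
    · simp
    · rw [h2]
      rfl
  rcases oc with _ | c
  · obtain rfl : sim = none := h
    exact hdead rfl rfl
  · obtain ⟨rfl, rfl, rfl, rfl⟩ := h
    by_cases hc : M.outcome c.state = none ∧ 0 < M.prob w c (dec r)
    · have hreach := (hoc c rfl).step hc.1 hc.2
      obtain ⟨xs, ys, blk₁, h0, h1, h2, h3, h4⟩ := exists_push_pop (C := C) c (dec r) v (by
        intro s hs
        apply hreach.work_eq_blank
        intro hz
        have h := Machine.abs_sub_lt_of_mem_visited hf hz hreach.workPos_mem
        have hpos : (M.next c (dec r)).workPos = c.workPos + sideSign s :=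
          moveWork_eq_of_moveSide hs _
        rw [hpos] at h
        -- The cell in question lies `v * C ≥ f` cells ahead of the new head position, hence was
        -- never visited.
        have e : c.workPos + sideSign s * (1 + (v * C : ℕ)) - (c.workPos + sideSign s) =
          sideSign s * (v * C : ℕ) := by ring
        rw [e, abs_mul, show |sideSign s| = 1 by cases s <;> rfl, one_mul, Nat.abs_cast] at h
        lia)
      have hcl : clampMove (inputAt w c.inputPos) (dec r).2.1 = (dec r).2.1 :=
        clampMove_eq_self M (q := c.state) (q' := (dec r).1) (γ := c.work c.workPos)
          (γ' := (dec r).2.2.1) (d' := (dec r).2.2.2) hc.2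
      refine ⟨some (dec r).1, (dec r).2.2.2, (dec r).2.1, xs, ys, blk₁,
        encBlocks C (M.next c (dec r)), ?_, fun j _ => h1 j, fun j _ => h2 j, h4, ?_⟩
      · rw [h0]
        exact if_pos hc
      · rw [simNext, Option.bind_some, if_pos hc, hcl]
        exact ⟨rfl, h3, rfl, rfl⟩
    · exact hdead (if_neg hc) (by rw [simNext, Option.bind_some, if_neg hc])

end Simulator

end PostTM

/-! ### Complete runs of the simulating machine. -/

namespace PostTM

open Filter Asymptotics

/-- Each of the factors is `2 ^ O(v)`; for the `n + 2` input head positions this is where space at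
least logarithmic is needed. -/
theorem configBound_le_two_pow {α : Type*} {Δ : Type} (M : Machine α Δ) {n f v A C : ℕ}
    (hn : n + 2 ≤ 2 ^ (A * v)) (hf : f ≤ C * v) (hv : 1 ≤ v) :
    M.configBound n f ≤ 2 ^ ((Fintype.card M.Q + (A + (C + Fintype.card M.Γ * C))) * v) := by
  unfold Machine.configBound
  have h1 : Fintype.card M.Q ≤ 2 ^ (Fintype.card M.Q * v) :=
    Nat.lt_two_pow_self.le.trans (Nat.pow_le_pow_right (by norm_num) (Nat.le_mul_of_pos_right _ hv))
  have h2 : f ≤ 2 ^ (C * v) := hf.trans Nat.lt_two_pow_self.le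
  have h3 : Fintype.card M.Γ ^ f ≤ 2 ^ (Fintype.card M.Γ * C * v) := by
    calc Fintype.card M.Γ ^ f ≤ (2 ^ Fintype.card M.Γ) ^ f :=
          Nat.pow_le_pow_left Nat.lt_two_pow_self.le _
      _ = 2 ^ (Fintype.card M.Γ * f) := (pow_mul _ _ _).symm
      _ ≤ _ := Nat.pow_le_pow_right (by norm_num) (by rw [mul_assoc]; gcongr)
  refine (Nat.mul_le_mul h1 (Nat.mul_le_mul hn (Nat.mul_le_mul h2 h3))).trans (le_of_eq ?_)
  rw [← pow_add, ← pow_add, ← pow_add]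
  congr 1
  ring

/-- At least one bit is requested so that a single value has probability at most `1/2`. -/
theorem exists_surjective_fin_two_pow (A : Type*) [Fintype A] [Nonempty A] :
    ∃ (m : ℕ) (dec : Fin (2 ^ m) → A), 1 ≤ m ∧ Function.Surjective dec := by
  classical
  have hle : Fintype.card A ≤ 2 ^ (Fintype.card A + 1) :=
    Nat.lt_two_pow_self.le.trans (Nat.pow_le_pow_right (by norm_num) (Nat.le_succ _))
  refine ⟨Fintype.card A + 1,
    fun r => if h : r.val < Fintype.card A then (Fintype.equivFin A).symm ⟨r, h⟩
      else Classical.arbitrary A, by lia, fun a => ?_⟩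
  have h := (Fintype.equivFin A a).isLt
  refine ⟨⟨Fintype.equivFin A a, h.trans_le hle⟩, ?_⟩
  simp

section Simulator

open StepMachine

variable {α : Type*} {Δ : Type} {D : Machine Unit Δ} {hD : D.IsDeterministic} {M : PTM α}
  {C b m : ℕ} {dec : Fin (2 ^ m) → M.Q × Move × M.Γ × Move} {w : List α} {ρ : ℕ → Fin (2 ^ m)}
  {lo : ℤ} {v k₁ f : ℕ} {g : ℕ → D.Γ}

/-- The simulating machine is at the start of the round with number `i`, where the simulated
machine is in configuration `oc`. -/
def AtRound (hD : D.IsDeterministic) (C b : ℕ) (dec : Fin (2 ^ m) → M.Q × Move × M.Γ × Move)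
    (w : List α) (ρ : ℕ → Fin (2 ^ m)) (lo : ℤ) (v : ℕ) (g : ℕ → D.Γ) (k i : ℕ)
    (oc : Option M.Config) : Prop :=
  (∃ sim x ip blk, (simulator D hD M C b dec).run w ρ k =
    ⟨.home sim x, ip, lo - 1, regionTape lo v (roundCells D M C b g blk i)⟩ ∧
    Represents C oc sim x ip blk) ∧
  (simulator D hD M C b dec).SafeUntil w ρ (lo - 1) (lo + v) k

theorem simOutcome_home {oc : Option M.Config} {sim : Option M.Q} {x : M.Γ} {ip : ℕ}
    {blk : ℕ → Bool → Fin C → M.Γ} (h : Represents C oc sim x ip blk) :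
    (simOutcome D M (.home sim x) = some true ∧
      ∃ c, oc = some c ∧ M.outcome c.state = some .accept) ∨
    (simOutcome D M (.home sim x) = none ∧
      ∀ c, oc = some c → M.outcome c.state ≠ some .accept) := by
  rcases oc with _ | c
  · obtain rfl : sim = none := h
    exact Or.inr ⟨rfl, by simp⟩
  · obtain ⟨rfl, rfl, rfl, rfl⟩ := h
    by_cases hc : M.outcome c.state = some .accept
    · exact Or.inl ⟨if_pos hc, c, rfl, hc⟩
    · refine Or.inr ⟨if_neg hc, ?_⟩
      rintro _ ⟨⟩
      exact hc

theorem AtRound.outcome_eq_true {oc : Option M.Config} {k i : ℕ}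
    (h : AtRound hD C b dec w ρ lo v g k i oc)
    (hacc : ∃ c, oc = some c ∧ M.outcome c.state = some .accept) :
    (simulator D hD M C b dec).outcome ((simulator D hD M C b dec).run w ρ k).state =
      some true := by
  obtain ⟨⟨sim, x, ip, blk, hrun, hrep⟩, -⟩ := h
  rw [hrun]
  rcases simOutcome_home (D := D) hrep with h | h
  · exact h.1
  · obtain ⟨c, hc, ho⟩ := hacc
    exact absurd ho (h.2 c hc)

/-- The round takes one step to leave home, `v` to push, one to turn, `v` to pop and one to return
home. -/
theorem AtRound.succ {oc : Option M.Config} {k i : ℕ}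
    (h : AtRound hD C b dec w ρ lo v g k i oc)
    (hf : (M.visited w).encard ≤ (f : ℕ∞)) (hfv : f ≤ v * C)
    (hoc : ∀ c, oc = some c → M.ReachedIn w i c)
    (hacc : ∀ c, oc = some c → M.outcome c.state ≠ some .accept) (hi : i + 1 < (b + 1) ^ v) :
    AtRound hD C b dec w ρ lo v g (k + (2 * v + 3)) (i + 1) (simNext dec w oc (ρ k)) := by
  obtain ⟨⟨sim, x, ip, blk, hrun, hrep⟩, hsafe⟩ := h
  have ho : simOutcome D M (.home sim x) = none := by
    rcases simOutcome_home (D := D) hrep with ⟨-, c, hc, h⟩ | h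
    · exact absurd h (hacc c hc)
    · exact h.1
  obtain ⟨sim', d, dᵢ, xs, ys, blk₁, blk₂, h1, h2, h3, h4, h5⟩ :=
    exists_round (D := D) (hD := hD) (b := b) (dec := dec) (r := ρ k) hf hfv hoc hrep
  obtain ⟨hpush, hs⟩ := simulator_push hrun ho h1 h2 hsafe
  have hdvd : ¬ (b + 1) ^ v ∣ i + 1 := fun h => absurd (Nat.le_of_dvd (by lia) h) (by lia)
  rw [decide_eq_false hdvd] at hpush
  obtain ⟨hpop, hs'⟩ := simulator_pop hpush h4 h3 hs
  rw [show k + (2 * v + 3) = k + 1 + v + 1 + v + 1 by ring]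
  exact ⟨⟨sim', ys 0, _, blk₂, hpop, h5⟩, hs'⟩

theorem AtRound.timeout {oc : Option M.Config} {k i : ℕ}
    (h : AtRound hD C b dec w ρ lo v g k i oc)
    (hf : (M.visited w).encard ≤ (f : ℕ∞)) (hfv : f ≤ v * C)
    (hoc : ∀ c, oc = some c → M.ReachedIn w i c)
    (hacc : ∀ c, oc = some c → M.outcome c.state ≠ some .accept) (hi : i + 1 = (b + 1) ^ v) :
    (simulator D hD M C b dec).SafeUntil w ρ (lo - 1) (lo + v) (k + v + 2) ∧
    (simulator D hD M C b dec).outcome ((simulator D hD M C b dec).run w ρ (k + v + 2)).state =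
      some false ∧ ((simulator D hD M C b dec).run w ρ (k + v + 2)).workPos = lo + v := by
  obtain ⟨⟨sim, x, ip, blk, hrun, hrep⟩, hsafe⟩ := h
  have ho : simOutcome D M (.home sim x) = none := by
    rcases simOutcome_home (D := D) hrep with ⟨-, c, hc, h⟩ | h
    · exact absurd h (hacc c hc)
    · exact h.1
  obtain ⟨sim', d, dᵢ, xs, ys, blk₁, blk₂, h1, h2, h3, h4, h5⟩ :=
    exists_round (D := D) (hD := hD) (b := b) (dec := dec) (r := ρ k) hf hfv hoc hrep
  obtain ⟨hpush, hs⟩ := simulator_push hrun ho h1 h2 hsafe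
  rw [decide_eq_true (hi ▸ dvd_rfl)] at hpush
  rw [show k + v + 2 = k + 1 + v + 1 by ring, simulator_timeout hpush]
  exact ⟨hs, rfl, rfl⟩

/-- Only the bits at the starts of rounds, the times `k₁ + i * (2 * v + 3)`, influence the
simulation; all others may be arbitrary. -/
theorem atRound_simTrace
    (h : AtRound hD C b dec w ρ lo v g k₁ 0 (some M.init))
    (hf : (M.visited w).encard ≤ (f : ℕ∞)) (hfv : f ≤ v * C) {r : ℕ → Fin (2 ^ m)}
    (hr : ∀ i, ρ (k₁ + i * (2 * v + 3)) = r i) {i : ℕ} (hi : i < (b + 1) ^ v)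
    (hacc : ∀ j < i, ∀ c, simTrace dec w r j = some c → M.outcome c.state ≠ some .accept) :
    AtRound hD C b dec w ρ lo v g (k₁ + i * (2 * v + 3)) i (simTrace dec w r i) := by
  induction i with
  | zero => simpa [simTrace] using h
  | succ i ih =>
    have := (ih (by lia) fun j hj => hacc j (by lia)).succ hf hfv
      (fun c => reachedIn_of_simTrace) (hacc i (by lia)) hi
    rw [hr] at this
    rw [show k₁ + (i + 1) * (2 * v + 3) = k₁ + i * (2 * v + 3) + (2 * v + 3) by ring]
    exact this

/-- Every run of the simulating machine either accepts at the start of some round, or halts when the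
clock has run out. -/
theorem simulator_halts
    (h : AtRound hD C b dec w ρ lo v g k₁ 0 (some M.init))
    (hf : (M.visited w).encard ≤ (f : ℕ∞)) (hfv : f ≤ v * C) :
    ∃ k o, (simulator D hD M C b dec).SafeUntil w ρ (lo - 1) (lo + v) k ∧
      (lo - 1 ≤ ((simulator D hD M C b dec).run w ρ k).workPos ∧
        ((simulator D hD M C b dec).run w ρ k).workPos ≤ lo + v) ∧
      (simulator D hD M C b dec).outcome ((simulator D hD M C b dec).run w ρ k).state = some o ∧
      (o = true → k ≤ k₁ + ((b + 1) ^ v - 1) * (2 * v + 3) ∧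
        ∃ i c, M.ReachedIn w i c ∧ M.outcome c.state = some .accept) ∧
      (o = false → k = k₁ + ((b + 1) ^ v - 1) * (2 * v + 3) + v + 2) := by
  classical
  have hB : 0 < (b + 1) ^ v := by positivity
  -- The run ends at the first round whose simulated configuration accepts, or else when the clock
  -- overflows in round `(b + 1) ^ v - 1`.
  by_cases hex : ∃ i, i < (b + 1) ^ v ∧ ∃ c,
      simTrace dec w (fun i => ρ (k₁ + i * (2 * v + 3))) i = some c ∧
        M.outcome c.state = some .accept
  · have hmin := fun j hj => Nat.find_min hex (m := j) hj
    obtain ⟨hi, hacc⟩ := Nat.find_spec hex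
    set i := Nat.find hex
    have hround := atRound_simTrace h hf hfv (r := fun i => ρ (k₁ + i * (2 * v + 3)))
      (fun _ => rfl) hi fun j hj c hc ho => hmin j hj ⟨by lia, c, hc, ho⟩
    refine ⟨_, true, hround.2, ?_, hround.outcome_eq_true hacc, fun _ => ⟨?_, ?_⟩, by simp⟩
    · obtain ⟨⟨sim, x, ip, blk, hrun, -⟩, -⟩ := hround
      rw [hrun]
      dsimp only
      lia
    · gcongr
      lia
    · obtain ⟨c, hc, ho⟩ := hacc
      exact ⟨i, c, reachedIn_of_simTrace hc, ho⟩
  · push Not at hex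
    have hround := atRound_simTrace h hf hfv (r := fun i => ρ (k₁ + i * (2 * v + 3)))
      (fun _ => rfl) (i := (b + 1) ^ v - 1) (by lia) fun j hj c hc => hex j (by lia) c hc
    obtain ⟨h1, h2, h3⟩ := hround.timeout hf hfv (fun c => reachedIn_of_simTrace)
      (fun c hc => hex _ (by lia) c hc) (by lia)
    exact ⟨_, false, h1, by rw [h3]; lia, h2, by simp, fun _ => rfl⟩

end Simulator

end PostTM

/-! ### From nondeterministic space to postselection. -/

namespace PostTM

open Filter Asymptotics StepMachine

theorem IsBigONat.of_le_mul {g h s : ℕ → ℕ} (hh : IsBigONat h s) (c : ℕ)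
    (hg : ∀ n, g n ≤ c * h n) : IsBigONat g s := by
  refine IsBigO.trans (IsBigO.of_bound c (Eventually.of_forall fun n => ?_)) hh
  rw [Real.norm_natCast, Real.norm_natCast]
  exact_mod_cast hg n

/-- A language in `NSPACE(s)` is in `PostRTISP(2 ^ O(s), s)` if there is a deterministic machine
that halts on all inputs and whose space is `O(s)` and at least `s`. -/
theorem mem_PostRTISP_of_mem_NSPACE {α : Type*} {s : ℕ → ℕ} {L : Language α} (D : PTM Unit)
    (hD : D.IsDeterministic) {fD : ℕ → ℕ} (hfD : IsBigONat fD s) (hDf : D.UsesSpace fD)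
    (hhalt : ∀ n, ∃ k c, D.ReachedIn (List.replicate n ()) k c ∧ D.outcome c.state ≠ none)
    (hs : ∀ n, s n ≤ (D.visited (List.replicate n ())).ncard)
    (hlog : IsBigONat (fun n => Nat.clog 2 (n + 2)) s) (hL : L ∈ NSPACE α s) :
    L ∈ PostRTISP α (twoPowBigO s) s := by
  obtain ⟨M, f, hf, hMf, hM⟩ := hL
  set v : ℕ → ℕ := fun n => (D.visited (List.replicate n ())).ncard with hv
  have hvfin : ∀ n, (D.visited (List.replicate n ())).Finite :=
    fun n => Set.finite_of_encard_le_coe (hDf _)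
  have hv1 : ∀ n, 1 ≤ v n := fun n =>
    (Set.ncard_pos (hvfin n)).2 ⟨_, Machine.ReachedIn.init.workPos_mem⟩
  have hvf : ∀ n, v n ≤ fD n := by
    intro n
    have := hDf (List.replicate n ())
    rw [← (hvfin n).cast_ncard_eq, List.length_replicate] at this
    exact_mod_cast this
  obtain ⟨C, hC⟩ := exists_le_mul_of_isBigONat hf hs hv1
  obtain ⟨A, hA⟩ := exists_le_mul_of_isBigONat hlog hs hv1
  have hn : ∀ n, n + 2 ≤ 2 ^ (A * v n) := fun n =>
    (Nat.le_pow_clog (by norm_num) _).trans (Nat.pow_le_pow_right (by norm_num) (hA n))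
  have : Nonempty (M.Q × Move × M.Γ × Move) := ⟨(M.start, .stay, M.blank, .stay)⟩
  obtain ⟨m, dec, hm, hdec⟩ := exists_surjective_fin_two_pow (M.Q × Move × M.Γ × Move)
  set E := Fintype.card M.Q + (A + (C + Fintype.card M.Γ * C)) with hE
  set E' := Fintype.card D.Q + (A + (1 + Fintype.card D.Γ * 1)) with hE'
  have hMbound : ∀ n, M.configBound n (f n) ≤ 2 ^ (E * v n) := fun n =>
    configBound_le_two_pow M (hn n) (hC n) (hv1 n)
  have hDbound : ∀ n, D.configBound n (v n) ≤ 2 ^ (E' * v n) := fun n =>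
    configBound_le_two_pow D (hn n) (one_mul (v n)).ge (hv1 n)
  -- With base `2 ^ E`, the `v n` digits of the clock count `2 ^ (E * v n)` rounds, at least the
  -- number of configurations of `M`.
  set b := 2 ^ E - 1 with hb
  have hb1 : ∀ n, (b + 1) ^ v n = 2 ^ (E * v n) := by
    intro n
    rw [hb, Nat.sub_add_cancel Nat.one_le_two_pow, pow_mul]
  choose k₀ c₀ hc₀ ho₀ using hhalt
  have hdata := fun n => Machine.exists_detRun_of_halts hD (hc₀ n) (ho₀ n) (hDf _)
  choose hdet hrun hk₀ lo hlo using hdata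
  simp only [List.length_replicate] at hk₀
  have hhalt : ∀ n, D.outcome (D.detRun hD (List.replicate n ()) (k₀ n)).state ≠ none := by
    intro n
    rw [← hdet]
    exact ho₀ n
  -- The run of `D` and its final marking, the way back to cell `lo - 1`, a turn, the rewinding of
  -- the input head, and the entry into the home state.
  set k₁ : ℕ → ℕ := fun n => k₀ n + 1 +
    ((D.detRun hD (List.replicate n ()) (k₀ n)).workPos - lo n + 1).toNat + 1 +
      (D.detRun hD (List.replicate n ()) (k₀ n)).inputPos + 1 with hk₁
  set N := simulator D hD M C b dec
  have hround : ∀ w ρ, AtRound hD C b dec w ρ (lo w.length) (v w.length)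
      (fun j => (D.detRun hD (List.replicate w.length ()) (k₀ w.length)).work (lo w.length + j))
      (k₁ w.length) 0 (some M.init) := by
    intro w ρ
    obtain ⟨h1, h2⟩ := simulator_init (M := M) (C := C) (b := b) (dec := dec) (w := w) (ρ := ρ)
      rfl (hrun _) (hhalt _) (hlo _) rfl
    exact ⟨⟨_, _, _, _, h1, rfl, rfl, rfl, rfl⟩, h2⟩
  have hCv : ∀ n, f n ≤ v n * C := fun n => (hC n).trans (mul_comm _ _).le
  have hmemL : ∀ w, w ∈ L ↔ ∃ k c, M.ReachedIn w k c ∧ M.outcome c.state = some .accept :=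
    fun w => (hM w).trans (M.haltProb_pos_iff w _)
  set X : ℕ → ℕ := fun n => k₁ n + ((b + 1) ^ v n - 1) * (2 * v n + 3) + v n + 2 with hX
  -- The exponents `E'` and `A` bound the preparation, `E` the number of rounds, and `8` the factor
  -- linear in `v n`.
  set G := E' + A + E + 8 with hG
  have hXle : ∀ n, X n ≤ 2 ^ (G * v n) := by
    intro n
    have hip : (D.detRun hD (List.replicate n ()) (k₀ n)).inputPos ≤ n + 1 := by
      rw [← hdet]
      simpa using (hc₀ n).inputPos_le
    have hwp : ((D.detRun hD (List.replicate n ()) (k₀ n)).workPos - lo n + 1).toNat ≤ v n := by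
      have := (hlo n _).1 ⟨k₀ n, le_rfl, rfl⟩
      lia
    have hk : k₁ n ≤ 2 ^ (E' * v n) + v n + 2 ^ (A * v n) + 2 := by
      have := (hk₀ n).trans_le (hDbound n)
      have := hn n
      simp only [hk₁]
      lia
    have hXle' : X n ≤ 2 ^ (E' * v n) + 2 ^ (A * v n) + 2 ^ (E * v n) * (4 * v n + 7) := by
      have h1 : ((b + 1) ^ v n - 1) * (2 * v n + 3) ≤ 2 ^ (E * v n) * (2 * v n + 3) :=
        Nat.mul_le_mul_right _ ((Nat.sub_le _ _).trans (hb1 n).le)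
      have h2 : 2 * v n + 4 ≤ 2 ^ (E * v n) * (2 * v n + 4) :=
        Nat.le_mul_of_pos_left _ (by positivity)
      have h3 : 2 ^ (E * v n) * (4 * v n + 7) =
        2 ^ (E * v n) * (2 * v n + 3) + 2 ^ (E * v n) * (2 * v n + 4) := by ring
      simp only [hX]
      lia
    have h8 : 4 * v n + 9 ≤ 2 ^ (8 * v n) := by
      have h1 := hv1 n
      have h2 : v n < 2 ^ v n := Nat.lt_two_pow_self
      calc 4 * v n + 9 ≤ 2 ^ 4 * 2 ^ v n := by lia
        _ = 2 ^ (4 + v n) := (pow_add _ _ _).symm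
        _ ≤ 2 ^ (8 * v n) := Nat.pow_le_pow_right (by norm_num) (by lia)
    have hsum : ∀ x y z u : ℕ, 1 ≤ x → 1 ≤ y → 1 ≤ z →
        x + y + z * u ≤ x * y * z * (u + 2) := by
      intro x y z u hx hy hz
      have h1 : x ≤ x * y * z := by rw [mul_assoc]; exact Nat.le_mul_of_pos_right _ (by positivity)
      have h2 : y ≤ x * y * z := by
        rw [mul_comm x y, mul_assoc]; exact Nat.le_mul_of_pos_right _ (by positivity)
      have h3 : z * u ≤ x * y * z * u :=
        Nat.mul_le_mul_right _ (Nat.le_mul_of_pos_left _ (by positivity))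
      rw [mul_add]
      lia
    refine hXle'.trans ((hsum _ _ _ _ Nat.one_le_two_pow Nat.one_le_two_pow
      Nat.one_le_two_pow).trans ?_)
    refine (Nat.mul_le_mul_left _ h8).trans (le_of_eq ?_)
    rw [← pow_add, ← pow_add, ← pow_add]
    congr 1
    simp only [hG]
    ring
  refine mem_PostRTISP (t := fun n => 2 ^ (G * v n)) (f := fun n => v n + 2) N hm
    (fun w => X w.length) ⟨fun n => G * v n, hfD.of_le_mul G fun n => ?_, rfl⟩
    (hfD.of_le_mul 3 fun n => ?_) (fun w => hXle _) ?_ ?_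
    (fun w => Set.Icc (lo w.length - 1) (lo w.length + v w.length)) ?_ ?_
  · exact Nat.mul_le_mul_left _ (hvf n)
  · have := hv1 n
    have := hvf n
    lia
  · intro w ρ
    obtain ⟨k, o, h1, -, h3, h4, h5⟩ := simulator_halts (hround w ρ) (hMf w) (hCv _)
    refine ⟨k, o, h1.running, h3, fun ho => ?_, h5⟩
    obtain ⟨h6, i, c, hc⟩ := h4 ho
    have := hv1 w.length
    exact ⟨by simp only [hX]; lia, (hmemL w).2 ⟨i, c, hc⟩⟩
  · intro w hw
    obtain ⟨k, c, hc, ho⟩ := (hmemL w).1 hw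
    -- A shortest path to an accepting configuration ends before the clock does.
    obtain ⟨K, hK, hc⟩ := hc.exists_lt_configBound (hMf w)
    obtain ⟨r, hr, hnone⟩ := exists_simTrace (dec := dec) hdec hc
    -- The guess for each round is held constant throughout the round; only its value in the first
    -- step of the round matters.
    refine ⟨fun i => if i < k₁ w.length then 0 else
      r ((i - k₁ w.length) / (2 * v w.length + 3)), k₁ w.length + K * (2 * v w.length + 3), ?_, ?_⟩
    · exact if_pos (by simp only [hk₁]; lia)
    · have := atRound_simTrace (hround w _) (hMf w) (hCv _) (i := K) (r := r)
        (ρ := fun i => if i < k₁ w.length then 0 else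
          r ((i - k₁ w.length) / (2 * v w.length + 3)))
        (fun i => by
          rw [if_neg (by lia), Nat.add_sub_cancel_left, Nat.mul_div_cancel _ (by lia)])
        (by rw [hb1]; exact hK.trans_le (hMbound _))
        (fun j hj c hc => by rw [hnone j hj c hc]; simp)
      exact ⟨this.2.running, this.outcome_eq_true ⟨c, hr, ho⟩⟩
  · intro w
    rw [← Finset.coe_Icc, Set.encard_coe_eq_coe_finsetCard, Int.card_Icc]
    refine Nat.cast_le.2 ?_
    lia
  · intro w ρ k hk
    obtain ⟨k', o, h1, h2, h3, -⟩ := simulator_halts (hround w ρ) (hMf w) (hCv _)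
    rcases lt_trichotomy k k' with hlt | rfl | hlt
    · exact (h1 k hlt).2
    · exact h2
    · have := hk k' hlt
      rw [h3] at this
      simp at this

end PostTM

/-! ### A binary counter that marks logarithmic space. -/

namespace PostTM

open Filter Asymptotics StepMachine

theorem StepMachine.isDeterministic_toMachine {α : Type*} {Δ : Type} (S : StepMachine α Δ 0) :
    S.toMachine.IsDeterministic := by
  classical
  intro q σ γ a
  have : Subsingleton (Fin (2 ^ 0)) := inferInstanceAs (Subsingleton (Fin 1))
  simp only [toMachine]
  rw [Fintype.sum_subsingleton _ 0]
  split_ifs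
  · right; norm_num
  · left; rfl

/-- The control states of the machine that writes the length of its input in binary. -/
inductive CounterState where
  | scan : CounterState
  | incr : CounterState
  | back : CounterState
  | halt : CounterState
  deriving DecidableEq

instance : Fintype CounterState :=
  ⟨{.scan, .incr, .back, .halt}, by intro q; cases q <;> simp⟩

/-- The transition function of the machine that writes the length of its input in binary. -/
def counterStep : CounterState → InputSymbol Unit → Option Bool →
    CounterState × Move × Option Bool × Move
  | .scan, .leftEnd, y => (.scan, .right, y, .stay)
  | .scan, .letter _, y => (.incr, .right, y, .stay)
  | .scan, .rightEnd, y => (.halt, .stay, y, .stay)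
  | .incr, _, some true => (.incr, .stay, some false, .right)
  | .incr, _, some false => (.back, .stay, some true, .left)
  | .incr, _, none => (.back, .stay, some true, .left)
  | .back, _, none => (.scan, .stay, none, .right)
  | .back, _, some x => (.back, .stay, some x, .left)
  | .halt, _, y => (.halt, .stay, y, .stay)

/-- The machine that writes the length of its input in binary. -/
abbrev counter : StepMachine Unit StdOutcome 0 where
  Q := CounterState
  Γ := Option Bool
  blank := none
  start := .scan
  outcome
    | .halt => some .accept
    | _ => none
  step q σ y _ := counterStep q σ y

/-- The work tape on which `t` is written in binary, the least significant bit in cell `0`. -/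
def binaryTape (t : ℕ) : ℤ → Option Bool := fun z =>
  if 0 ≤ z ∧ 2 ^ z.toNat ≤ t then some (decide (t / 2 ^ z.toNat % 2 = 1)) else none

theorem binaryTape_natCast (t j : ℕ) :
    binaryTape t j = if 2 ^ j ≤ t then some (decide (t / 2 ^ j % 2 = 1)) else none := by
  simp [binaryTape]

/-- The hypothesis says that bits `0, …, j` of `t` are all ones, so incrementing turns them to
zeros. -/
theorem binaryTape_of_dvd {t j : ℕ} (h : 2 ^ (j + 1) ∣ t + 1) :
    binaryTape t j = some true ∧ binaryTape (t + 1) j = some false := by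
  have hle := Nat.le_of_dvd (Nat.succ_pos t) h
  have hpos : 0 < 2 ^ j := by positivity
  rw [pow_succ] at hle
  have h1 : (t + 1) / 2 ^ j = t / 2 ^ j + 1 := by
    rw [Nat.succ_div, if_pos ((pow_dvd_pow 2 (Nat.le_succ j)).trans h)]
  have h2 : 2 ∣ (t + 1) / 2 ^ j := by
    rw [Nat.dvd_div_iff_mul_dvd ((pow_dvd_pow 2 (Nat.le_succ j)).trans h), ← pow_succ]
    exact h
  rw [binaryTape_natCast, binaryTape_natCast, if_pos (by lia), if_pos (by lia)]
  simp only [Option.some.injEq, decide_eq_true_eq, decide_eq_false_iff_not]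
  lia

/-- Here `j` is the place where the carry stops: cell `j` holds a zero, or a blank if the number
gets longer, and receives a one. -/
theorem binaryTape_of_not_dvd {t j : ℕ} (h : 2 ^ j ∣ t + 1) (h' : ¬ 2 ^ (j + 1) ∣ t + 1) :
    binaryTape t j ≠ some true ∧ binaryTape (t + 1) j = some true := by
  have hle := Nat.le_of_dvd (Nat.succ_pos t) h
  have h1 : (t + 1) / 2 ^ j = t / 2 ^ j + 1 := by rw [Nat.succ_div, if_pos h]
  have h2 : ¬ 2 ∣ (t + 1) / 2 ^ j := by
    rw [Nat.dvd_div_iff_mul_dvd h, ← pow_succ]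
    exact h'
  rw [binaryTape_natCast, binaryTape_natCast, if_pos hle]
  constructor
  · split_ifs
    · simp only [ne_eq, Option.some.injEq, decide_eq_true_eq]
      lia
    · simp
  · simp only [Option.some.injEq, decide_eq_true_eq]
    lia

theorem binaryTape_succ_of_not_dvd {t j : ℕ} (h : ¬ 2 ^ j ∣ t + 1) :
    binaryTape (t + 1) j = binaryTape t j := by
  have hne : 2 ^ j ≠ t + 1 := fun h' => h (h' ▸ dvd_rfl)
  rw [binaryTape_natCast, binaryTape_natCast, Nat.succ_div, if_neg h, add_zero]
  exact if_congr (by lia) rfl rfl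

theorem binaryTape_of_neg {t : ℕ} {z : ℤ} (hz : z < 0) : binaryTape t z = none :=
  if_neg (by lia)

section Counter

variable {w : List Unit} {ρ : ℕ → Fin (2 ^ 0)} {k ip t : ℕ}

theorem counter_incr (h : counter.run w ρ k = ⟨.incr, ip, 0, binaryTape t⟩) {j : ℕ}
    (hj : 2 ^ j ∣ t + 1) : counter.run w ρ (k + j) =
      ⟨.incr, ip, j, fun z => if z < j then binaryTape (t + 1) z else binaryTape t z⟩ := by
  induction j with
  | zero =>
    rw [add_zero, h]
    congr 1
    funext z
    split_ifs with hz
    · rw [binaryTape_of_neg hz, binaryTape_of_neg hz]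
    · rfl
  | succ j ih =>
    obtain ⟨h1, h2⟩ := binaryTape_of_dvd hj
    have := run_succ_eq (q' := CounterState.incr) (d := .stay) (x := some false) (d' := .right)
      (ih ((pow_dvd_pow 2 (Nat.le_succ j)).trans hj)) ((if_neg (lt_irrefl _)).trans h1) rfl
    rw [clampMove_stay] at this
    rw [← add_assoc, this]
    congr 1
    funext z
    rcases eq_or_ne z j with rfl | hz
    · rw [Function.update_self, if_pos (by push_cast; lia), h2]
    · rw [Function.update_of_ne hz]
      exact if_congr (by push_cast; lia) rfl rfl

theorem counter_back {j : ℕ} (h : counter.run w ρ k = ⟨.back, ip, (j : ℤ) - 1, binaryTape t⟩)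
    (hj : 2 ^ j ≤ t) {i : ℕ} (hi : i ≤ j) :
    counter.run w ρ (k + i) = ⟨.back, ip, (j : ℤ) - 1 - i, binaryTape t⟩ := by
  induction i with
  | zero => simpa using h
  | succ i ih =>
    have e : (j : ℤ) - 1 - i = (j - 1 - i : ℕ) := by lia
    have hle : 2 ^ (j - 1 - i) ≤ t := (Nat.pow_le_pow_right (by norm_num) (by lia)).trans hj
    have hx : ∃ x, binaryTape t ((j : ℤ) - 1 - i) = some x := by
      rw [e, binaryTape_natCast, if_pos hle]
      exact ⟨_, rfl⟩
    obtain ⟨x, hx⟩ := hx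
    have := run_succ_eq (q' := CounterState.back) (d := .stay) (x := some x) (d' := .left)
      (ih (by lia)) hx rfl
    rw [clampMove_stay, ← hx, Function.update_eq_self] at this
    rw [← add_assoc, this]
    congr 1
    simp only [Machine.moveWork]
    push_cast
    ring

theorem counter_round {n : ℕ} (hw : w.length = n) (ht : t < n)
    (h : counter.run w ρ k = ⟨.scan, t + 1, 0, binaryTape t⟩)
    (hs : counter.SafeUntil w ρ (-1) (Nat.log 2 n) k) :
    ∃ k', counter.run w ρ k' = ⟨.scan, t + 2, 0, binaryTape (t + 1)⟩ ∧
      counter.SafeUntil w ρ (-1) (Nat.log 2 n) k' := by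
  classical
  have hex : ∃ j, ¬ 2 ^ (j + 1) ∣ t + 1 := by
    refine ⟨t + 1, fun hd => ?_⟩
    have h1 := Nat.le_of_dvd (Nat.succ_pos t) hd
    have h2 : t + 1 + 1 < 2 ^ (t + 1 + 1) := Nat.lt_two_pow_self
    lia
  -- `j` is the number of trailing ones of `t`.
  set j := Nat.find hex with hj
  have hnd : ¬ 2 ^ (j + 1) ∣ t + 1 := Nat.find_spec hex
  have hd : 2 ^ j ∣ t + 1 := by
    rcases Nat.eq_zero_or_pos j with h0 | hpos
    · rw [h0, pow_zero]
      exact one_dvd _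
    · have := Nat.find_min hex (m := j - 1) (by lia)
      rwa [not_not, Nat.sub_add_cancel hpos] at this
  have hjle : 2 ^ j ≤ t + 1 := Nat.le_of_dvd (Nat.succ_pos t) hd
  have hjlog : j ≤ Nat.log 2 n := Nat.le_log_of_pow_le (by norm_num) (by lia)
  have hin : inputAt w (t + 1) = .letter () := by
    simp only [inputAt]
    rw [List.getElem?_eq_getElem (by lia)]
  have h1 := run_succ_eq (S := counter) (q' := CounterState.incr) (d := .right)
    (x := binaryTape t 0) (d' := .stay) h rfl (by rw [hin]; rfl)
  rw [hin, Function.update_eq_self] at h1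
  have hs1 := hs.add_of_run (n := 1) (q := fun _ => CounterState.scan) (ip := fun _ => t + 1)
    (wp := fun _ => 0) (work := fun _ => binaryTape t) (fun i hi => by
      obtain rfl : i = 0 := by lia
      exact h) (fun _ _ => rfl) (fun _ _ => by lia) (fun _ _ => by lia)
  have h2 := fun i (hi : i ≤ j) => counter_incr (j := i) h1 ((pow_dvd_pow 2 hi).trans hd)
  have hs2 := hs1.add_of_run (n := j + 1) (fun i hi => h2 i (by lia)) (fun _ _ => rfl)
    (fun _ _ => by lia) (fun _ _ => by lia)
  obtain ⟨h3, h4⟩ := binaryTape_of_not_dvd hd hnd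
  have h5 := run_succ_eq (S := counter) (q' := CounterState.back) (d := .stay) (x := some true)
    (d' := .left) (h2 j le_rfl) (if_neg (lt_irrefl _)) (by
      revert h3
      rcases binaryTape t j with _ | _ | _
      · intro _; rfl
      · intro _; rfl
      · intro h; exact absurd rfl h)
  have htape : Function.update
      (fun z : ℤ => if z < j then binaryTape (t + 1) z else binaryTape t z) j (some true) =
      binaryTape (t + 1) := by
    funext z
    rcases eq_or_ne z j with rfl | hz
    · rw [Function.update_self, h4]
    · rw [Function.update_of_ne hz]
      split_ifs with hlt
      · rfl
      · obtain ⟨i, rfl⟩ := Int.eq_ofNat_of_zero_le (show 0 ≤ z by lia)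
        refine (binaryTape_succ_of_not_dvd fun hi => hnd ?_).symm
        exact (pow_dvd_pow 2 (by lia)).trans hi
  rw [htape, clampMove_stay] at h5
  have h6 := fun i (hi : i ≤ j) => counter_back (j := j) (i := i) h5 hjle hi
  have hs3 := hs2.add_of_run (n := j + 1) (fun i hi => h6 i (by lia)) (fun _ _ => rfl)
    (fun _ _ => by lia) (fun _ _ => by lia)
  have h7 := h6 j le_rfl
  rw [show (j : ℤ) - 1 - j = -1 by ring] at h7
  have hblank : binaryTape (t + 1) (-1) = none := binaryTape_of_neg (by lia)
  have h8 := run_succ_eq (S := counter) (q' := CounterState.scan) (d := .stay) (x := none)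
    (d' := .right) h7 hblank rfl
  rw [clampMove_stay, ← hblank, Function.update_eq_self] at h8
  exact ⟨_, h8, hs3⟩

theorem counter_halts (w : List Unit) (ρ : ℕ → Fin (2 ^ 0)) : ∃ k ip,
    counter.run w ρ k = ⟨.halt, ip, 0, binaryTape w.length⟩ ∧
      counter.SafeUntil w ρ (-1) (Nat.log 2 w.length) k := by
  have h0 : counter.run w ρ 0 = ⟨.scan, 0, 0, binaryTape 0⟩ := by
    simp only [run]
    congr 1
    funext z
    exact (if_neg fun h => absurd h.2 (Nat.two_pow_pos _).not_ge).symm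
  have hs0 : counter.SafeUntil w ρ (-1) (Nat.log 2 w.length) 0 := fun i hi => by lia
  have key : ∀ t ≤ w.length, ∃ k, counter.run w ρ k = ⟨.scan, t + 1, 0, binaryTape t⟩ ∧
      counter.SafeUntil w ρ (-1) (Nat.log 2 w.length) k := by
    intro t
    induction t with
    | zero =>
      intro _
      refine ⟨0 + 1, ?_, hs0.add_of_run (n := 1) (q := fun _ => CounterState.scan)
        (ip := fun _ => 0) (wp := fun _ => 0) (work := fun _ => binaryTape 0) (fun i hi => by
          obtain rfl : i = 0 := by lia
          exact h0) (fun _ _ => rfl) (fun _ _ => by lia) (fun _ _ => by lia)⟩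
      rw [run_succ_eq (S := counter) (q' := CounterState.scan) (d := .right)
        (x := binaryTape 0 0) (d' := .stay) h0 rfl rfl, Function.update_eq_self]
      rfl
    | succ t ih =>
      intro ht
      obtain ⟨k, h, hs⟩ := ih (by lia)
      exact counter_round rfl (by lia) h hs
  obtain ⟨k, h, hs⟩ := key w.length le_rfl
  have hin := Machine.inputAt_length_add_one w
  have h1 := run_succ_eq (S := counter) (q' := CounterState.halt) (d := .stay)
    (x := binaryTape w.length 0) (d' := .stay) h rfl (by rw [hin]; rfl)
  rw [Function.update_eq_self] at h1
  exact ⟨k + 1, _, h1, hs.add_of_run (n := 1) (q := fun _ => CounterState.scan)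
    (ip := fun _ => w.length + 1) (wp := fun _ => 0) (work := fun _ => binaryTape w.length)
    (fun i hi => by
      obtain rfl : i = 0 := by lia
      exact h) (fun _ _ => rfl) (fun _ _ => by lia) (fun _ _ => by lia)⟩

/-- The digits of numbers up to `n` lie in cells `0` to `Nat.log 2 n`, and the head also visits the
blank cell `-1` to recognize the left end. -/
theorem counter_usesSpace : counter.toMachine.UsesSpace fun n => Nat.log 2 n + 2 := by
  intro w
  refine (Set.encard_le_encard (t := Set.Icc (-1 : ℤ) (Nat.log 2 w.length)) ?_).trans ?_
  · rintro z ⟨k, c, hc, rfl⟩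
    obtain ⟨ρ, h0, hr, rfl⟩ := exists_run_of_reachedIn hc
    obtain ⟨k', ip, h, hs⟩ := counter_halts w ρ
    rcases lt_trichotomy k k' with hlt | rfl | hlt
    · exact (hs k hlt).2
    · change (counter.run w ρ k).workPos ∈ _
      rw [h]
      constructor <;> dsimp only <;> lia
    · have := hr k' hlt
      rw [h] at this
      simp at this
  · rw [← Finset.coe_Icc, Set.encard_coe_eq_coe_finsetCard, Int.card_Icc]
    refine Nat.cast_le.2 ?_
    lia

theorem counter_reaches_halt (n : ℕ) : ∃ k c,
    counter.toMachine.ReachedIn (List.replicate n ()) k c ∧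
      counter.toMachine.outcome c.state ≠ none ∧ c.work = binaryTape n := by
  obtain ⟨k, ip, h, hs⟩ := counter_halts (List.replicate n ()) fun _ => 0
  rw [List.length_replicate] at h
  refine ⟨k, _, reachedIn_withRand_run rfl hs.running, ?_, ?_⟩
  · rw [h]
    exact Option.some_ne_none _
  · rw [h]
    rfl

theorem log_le_ncard_visited_counter (n : ℕ) :
    Nat.log 2 n ≤ (counter.toMachine.visited (List.replicate n ())).ncard := by
  rcases Nat.eq_zero_or_pos n with rfl | hn
  · simp
  obtain ⟨k, c, hc, -, hwork⟩ := counter_reaches_halt n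
  have hfin : (counter.toMachine.visited (List.replicate n ())).Finite :=
    Set.finite_of_encard_le_coe (counter_usesSpace _)
  have hsub : ((fun i : ℕ => (i : ℤ)) '' (Finset.range (Nat.log 2 n) : Set ℕ)) ⊆
      counter.toMachine.visited (List.replicate n ()) := by
    rintro _ ⟨i, hi, rfl⟩
    by_contra hi'
    have := hc.work_eq_blank hi'
    rw [hwork] at this
    change binaryTape n i = none at this
    rw [binaryTape_natCast, if_pos] at this
    · simp at this
    · have hi : i < Nat.log 2 n := by simpa using hi
      exact (Nat.pow_le_pow_right (by norm_num) hi.le).trans (Nat.pow_log_le_self 2 hn.ne')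
  have := Set.ncard_le_ncard hsub hfin
  rwa [Set.ncard_image_of_injective _ Nat.cast_injective, Set.ncard_coe_finset,
    Finset.card_range] at this

end Counter

end PostTM

/-! ### Logarithmic bounds, the converse inclusion, and the conclusion. -/

namespace PostTM

open Filter Asymptotics

theorem isBigONat_of_eventually_le {g s : ℕ → ℕ} (c : ℕ) (h : ∀ᶠ n in atTop, g n ≤ c * s n) :
    IsBigONat g s := by
  refine IsBigO.of_bound c (h.mono fun n hn => ?_)
  rw [Real.norm_natCast, Real.norm_natCast]
  exact_mod_cast hn

theorem one_le_log_two_of_two_le {n : ℕ} (hn : 2 ≤ n) : 1 ≤ Nat.log 2 n :=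
  Nat.le_log_of_pow_le (by norm_num) (by simpa using hn)

theorem isBigONat_clog_log : IsBigONat (fun n => Nat.clog 2 (n + 2)) (fun n => Nat.log 2 n) := by
  refine isBigONat_of_eventually_le 4 ((eventually_ge_atTop 2).mono fun n hn => ?_)
  refine Nat.clog_le_of_le_pow ?_
  have h1 := one_le_log_two_of_two_le hn
  have h2 : n < 2 ^ (Nat.log 2 n + 1) := Nat.lt_pow_succ_log_self (by norm_num) n
  calc n + 2 ≤ n * n := by nlinarith
    _ ≤ 2 ^ (Nat.log 2 n + 1) * 2 ^ (Nat.log 2 n + 1) := Nat.mul_le_mul h2.le h2.le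
    _ = 2 ^ (Nat.log 2 n + 1 + (Nat.log 2 n + 1)) := (pow_add _ _ _).symm
    _ ≤ 2 ^ (4 * Nat.log 2 n) := Nat.pow_le_pow_right (by norm_num) (by lia)

theorem isBigO_natLog_log :
    (fun n : ℕ => (Nat.log 2 n : ℝ)) =O[atTop] fun n : ℕ => Real.log (n : ℝ) := by
  refine IsBigO.of_bound (1 / Real.log 2) (Eventually.of_forall fun n => ?_)
  have h2 : 0 < Real.log 2 := Real.log_pos (by norm_num)
  have hn : 0 ≤ Real.log n := Real.log_natCast_nonneg n
  rw [Real.norm_natCast, Real.norm_of_nonneg hn, one_div_mul_eq_div]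
  exact_mod_cast Real.natLog_le_logb n 2

theorem isBigONat_two_pow_le_polynomial {g : ℕ → ℕ} (hg : IsBigONat g fun n => Nat.log 2 n) :
    ∃ p : Polynomial ℕ, ∀ n, 2 ^ g n ≤ p.eval n := by
  obtain ⟨c, hc⟩ := hg.bound
  obtain ⟨n₀, hn₀⟩ := eventually_atTop.1 hc
  -- The constant covers the initial values; the range extends to `n₀ + 1` so that the remaining `n`
  -- are positive and satisfy `2 ^ Nat.log 2 n ≤ n`.
  refine ⟨Polynomial.X ^ ⌈c⌉₊ + Polynomial.C (∑ i ∈ Finset.range (n₀ + 1), 2 ^ g i), fun n => ?_⟩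
  simp only [Polynomial.eval_add, Polynomial.eval_pow, Polynomial.eval_X, Polynomial.eval_C]
  rcases lt_or_ge n (n₀ + 1) with hn | hn
  · refine le_add_left ?_
    exact Finset.single_le_sum (f := fun i => 2 ^ g i) (fun _ _ => Nat.zero_le _)
      (Finset.mem_range.2 hn)
  · refine le_add_right ?_
    have h1 := hn₀ n (by lia)
    rw [Real.norm_natCast, Real.norm_natCast] at h1
    have h2 : (g n : ℝ) ≤ (Nat.log 2 n * ⌈c⌉₊ : ℕ) := by
      push_cast
      rw [mul_comm]
      exact h1.trans (mul_le_mul_of_nonneg_right (Nat.le_ceil c) (Nat.cast_nonneg _))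
    have h3 : g n ≤ Nat.log 2 n * ⌈c⌉₊ := by exact_mod_cast h2
    calc 2 ^ g n ≤ 2 ^ (Nat.log 2 n * ⌈c⌉₊) := Nat.pow_le_pow_right (by norm_num) h3
      _ = (2 ^ Nat.log 2 n) ^ ⌈c⌉₊ := pow_mul _ _ _
      _ ≤ n ^ ⌈c⌉₊ := Nat.pow_le_pow_left (Nat.pow_log_le_self 2 (by lia)) _

namespace Machine

variable {α : Type*} {Δ Δ' : Type}

/-- Rename the halting outcomes. -/
def mapOutcome (M : Machine α Δ) (e : Δ → Δ') : Machine α Δ' where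
  Q := M.Q
  Γ := M.Γ
  blank := M.blank
  start := M.start
  outcome q := (M.outcome q).map e
  δ := M.δ
  δ_polyTime := M.δ_polyTime
  δ_sum := M.δ_sum
  δ_leftEnd := M.δ_leftEnd
  δ_rightEnd := M.δ_rightEnd

/-- Renaming the halting outcomes does not change the configurations. -/
def Config.mapOutcome {M : Machine α Δ} (c : M.Config) (e : Δ → Δ') : (M.mapOutcome e).Config :=
  ⟨c.state, c.inputPos, c.workPos, c.work⟩

theorem reachedIn_mapOutcome {M : Machine α Δ} {w : List α} {k : ℕ} {e : Δ → Δ'}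
    {c : (M.mapOutcome e).Config} : (M.mapOutcome e).ReachedIn w k c ↔
      ∃ c', M.ReachedIn w k c' ∧ c = c'.mapOutcome e := by
  constructor
  · intro h
    induction h with
    | init => exact ⟨M.init, .init, rfl⟩
    | @step k c r hc ho hp ih =>
      obtain ⟨c', hc', rfl⟩ := ih
      exact ⟨M.next c' r, hc'.step (Option.map_eq_none_iff.1 ho) hp, rfl⟩
  · rintro ⟨c', hc', rfl⟩
    induction hc' with
    | init => exact .init
    | @step k c r hc ho hp ih =>
      exact ReachedIn.step (M := M.mapOutcome e) (r := r) ih (Option.map_eq_none_iff.2 ho) hp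

end Machine

/-- Overall acceptance is postselected acceptance divided by a positive number, so its positivity
means that a postselection-accept state is reachable. -/
theorem PostRTISP_subset_NSPACE (α : Type*) (T : Set (ℕ → ℕ)) (s : ℕ → ℕ) :
    PostRTISP α T s ⊆ NSPACE α s := by
  rintro L ⟨M, t, f, -, hf, -, hspace, hL, -⟩
  let e : PostOutcome → StdOutcome := fun o => if o = .postAccept then .accept else .reject
  refine ⟨M.toMachine.mapOutcome e, f, hf, fun w => ?_, fun w => ?_⟩
  · refine (Set.encard_le_encard ?_).trans (hspace w)
    rintro z ⟨k, c, hc, rfl⟩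
    obtain ⟨c', hc', rfl⟩ := Machine.reachedIn_mapOutcome.1 hc
    exact ⟨k, c', hc', rfl⟩
  · rw [hL w, PostPTM.acceptProb, div_pos_iff_of_pos_right (M.post_pos w),
      Machine.haltProb_pos_iff, Machine.haltProb_pos_iff]
    constructor
    · rintro ⟨k, c, hc, ho⟩
      refine ⟨k, c.mapOutcome e, Machine.reachedIn_mapOutcome.2 ⟨c, hc, rfl⟩, ?_⟩
      change (M.outcome c.state).map e = _
      rw [ho]
      rfl
    · rintro ⟨k, c, hc, ho⟩
      obtain ⟨c', hc', rfl⟩ := Machine.reachedIn_mapOutcome.1 hc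
      refine ⟨k, c', hc', ?_⟩
      obtain ⟨o, ho', he⟩ := Option.map_eq_some_iff.1
        (show (M.outcome c'.state).map e = some .accept from ho)
      cases o
      · exact ho'
      · simp [e] at he
      · simp [e] at he

theorem PostRTISP_subset_of_forall_le {α : Type*} {T T' : Set (ℕ → ℕ)} {s : ℕ → ℕ}
    (h : ∀ t ∈ T, ∃ t' ∈ T', ∀ n, t n ≤ t' n) : PostRTISP α T s ⊆ PostRTISP α T' s := by
  rintro L ⟨M, t, f, ht, hf, htime, hspace, hL⟩
  obtain ⟨t', ht', hle⟩ := h t ht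
  exact ⟨M, t', f, ht', hf, fun w k c hc ho => (htime w k c hc ho).trans_le (hle _), hspace, hL⟩

/-- A nonblank cell must have been visited, so the machine that constructs `s` visits at least `s n`
cells and can mark the space. -/
theorem NSPACE_subset_PostRTISP {α : Type*} {s : ℕ → ℕ} (hs : SpaceConstructible s)
    (hlog : (fun n : ℕ => Real.log (n : ℝ)) =O[atTop] fun n : ℕ => (s n : ℝ)) :
    NSPACE α s ⊆ PostRTISP α (twoPowBigO s) s := by
  obtain ⟨D, f, hD, hf, hspace, hhalt⟩ := hs
  intro L hL
  refine mem_PostRTISP_of_mem_NSPACE D hD hf hspace (fun n => ?_) (fun n => ?_)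
    (isBigONat_clog_log.trans (isBigO_natLog_log.trans hlog)) hL
  · obtain ⟨k, c, hc, ho, -⟩ := hhalt n
    exact ⟨k, c, hc, ho⟩
  · obtain ⟨k, c, hc, -, hcard⟩ := hhalt n
    have hsub : {z : ℤ | c.work z ≠ D.blank} ⊆ D.visited (List.replicate n ()) := by
      intro z hz
      by_contra hz'
      exact hz (hc.work_eq_blank hz')
    have h := Set.encard_le_encard hsub
    rw [hcard, ← (Set.finite_of_encard_le_coe (hspace (List.replicate n ()))).cast_ncard_eq] at h
    exact_mod_cast h

/-- It suffices that the marking machine visits at least `Nat.log 2 n` and `O(log n)` cells; a count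
of exactly `Nat.log 2 n` nonblank cells is not needed, so the binary counter serves. -/
theorem NL_subset_PostRL (α : Type*) : NL α ⊆ PostRL α := by
  intro L hL
  refine PostRTISP_subset_of_forall_le ?_ (mem_PostRTISP_of_mem_NSPACE counter.toMachine
    counter.isDeterministic_toMachine (fD := fun n => Nat.log 2 n + 2) ?_ counter_usesSpace
    (fun n => ?_) log_le_ncard_visited_counter isBigONat_clog_log hL)
  · rintro t ⟨g, hg, rfl⟩
    obtain ⟨p, hp⟩ := isBigONat_two_pow_le_polynomial hg
    exact ⟨_, ⟨p, rfl⟩, hp⟩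
  · refine isBigONat_of_eventually_le 3 ((eventually_ge_atTop 2).mono fun n hn => ?_)
    have := one_le_log_two_of_two_le hn
    lia
  · obtain ⟨k, c, hc, ho, -⟩ := counter_reaches_halt n
    exact ⟨k, c, hc, ho⟩

end PostTM

theorem mainTheorem6 {α : Type*} [Finite α] :
    (∀ s : ℕ → ℕ, PostTM.SpaceConstructible s →
      (fun n : ℕ => Real.log (n : ℝ)) =O[Filter.atTop] (fun n : ℕ => (s n : ℝ)) →
      PostTM.NSPACE α s = PostTM.PostRTISP α (PostTM.twoPowBigO s) s) ∧
    PostTM.NL α = PostTM.PostRL α :=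
  ⟨fun _ hs hlog => (PostTM.NSPACE_subset_PostRTISP hs hlog).antisymm
      (PostTM.PostRTISP_subset_NSPACE α _ _),
    (PostTM.NL_subset_PostRL α).antisymm (PostTM.PostRTISP_subset_NSPACE α _ _)⟩
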